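/- Sparse Spanning Subgraph (SSS): given an $n$-node undirected graph $G$ and $0<\varepsilon<1$, output a subgraph $H$ of $G$ that has the same connected components as $G$ and at most $(1+\varepsilon)n$ edges. A local computation algorithm (LCA) for SSS is a single program that receives $n$, $\varepsilon$ and one edge $(u,v)\in E(G)$ as its query, and that answers YES or NO. There is no preprocessing, and nothing is kept from one query to the next, except that all queries use the same infinite tape of independent fair random bits, read from its beginning. The program has access to $G$ both by adjacency lists in arbitrary order (reading the degree of a node, or the $i$-th neighbour of a node) and by the adjacency matrix. It runs on a random access machine with logarithmic cost (every instruction, access to $G$ included, costs one plus the number of binary digits of the numbers it handles; reading a random bit costs $1$), and $\varepsilon$ is handed to it as the integer $\lceil 1/\varepsilon\rceil$. **Corollary.** For every constant $c \in \mathbb{N}$ there are an LCA for SSS and constants $C, d$ such that, for every $n\ge 1$, every $n$-node graph $G$ (with any order of its adjacency lists) and every $0<\varepsilon<1$: 1. for every random tape and every query $(u,v)\in E(G)$, the program halts within time $C\,\frac{n}{\varepsilon}\,(1+\log n)^{d}$, i.e. the query time is $\widetilde O(n\varepsilon^{-1})$; 2. with probability at least $1-n^{-c}$ over the shared random tape,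 the set of edges of $G$ to which the program answers YES is (the edge set of) a solution of SSS on $(G,\varepsilon)$. -/

import Mathlib

namespace SSSLocal

/-- An `n`-node undirected graph on the node set `{0, …, n-1}`, presented by adjacency lists: for
each node, a list of its neighbours, each occurring exactly once, in arbitrary order. -/
structure GraphInput (n : ℕ) where
  graph : SimpleGraph (Fin n)
  nbrs : Fin n → List (Fin n)
  nodup : ∀ v, (nbrs v).Nodup
  mem_nbrs : ∀ v w, w ∈ nbrs v ↔ graph.Adj v w

/-- `H` is a solution of Sparse Spanning Subgraph on `(G, ε)`: a subgraph of `G` with the same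
connected components and with at most `(1 + ε) n` edges. -/
def IsSSS {n : ℕ} (G : SimpleGraph (Fin n)) (ε : ℝ) (H : SimpleGraph (Fin n)) : Prop :=
  H ≤ G ∧ (∀ u v, H.Reachable u v ↔ G.Reachable u v) ∧
    (H.edgeSet.ncard : ℝ) ≤ (1 + ε) * n

/-! ### Access to the input graph: node and index arguments are natural numbers -/

namespace GraphInput

variable {n : ℕ} (I : GraphInput n)

/-- The length of the adjacency list of node `v` (`0` if there is no node `v`). -/
def degAt (v : ℕ) : ℕ :=
  if h : v < n then (I.nbrs ⟨v, h⟩).length else 0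

/-- The entry number `i` (counted from `0`) of the adjacency list of node `v`
(`0` if there is no such entry). -/
def nbrAt (v i : ℕ) : ℕ :=
  if h : v < n then (((I.nbrs ⟨v, h⟩)[i]?).map Fin.val).getD 0 else 0

open Classical in
/-- The entry `(u, v)` of the adjacency matrix (`0` if `u` or `v` is not a node). -/
noncomputable def adjAt (u v : ℕ) : ℕ :=
  if ∃ (hu : u < n) (hv : v < n), I.graph.Adj ⟨u, hu⟩ ⟨v, hv⟩ then 1 else 0

end GraphInput

/-! ### Random access machine with logarithmic cost -/

/-- Arithmetic and comparison operations. -/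
inductive BinOp
  | add | sub | mul | div | mod | lt | eq

/-- Subtraction is truncated at `0`, `div` and `mod` are quotient and remainder (with `a / 0 = 0`
and `a % 0 = a`), comparisons return `1` for true and `0` for false. -/
def BinOp.eval : BinOp → ℕ → ℕ → ℕ
  | .add, a, b => a + b
  | .sub, a, b => a - b
  | .mul, a, b => a * b
  | .div, a, b => a / b
  | .mod, a, b => a % b
  | .lt, a, b => if a < b then 1 else 0
  | .eq, a, b => if a = b then 1 else 0

/-- Elementary instructions. All arguments except the literal of `const` are register names. -/
inductive Instr
  /-- `reg d := k` -/
  | const (d k : ℕ)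
  /-- `reg d := o (reg a) (reg b)` -/
  | op (o : BinOp) (d a b : ℕ)
  /-- `reg d := mem[reg a]` -/
  | load (d a : ℕ)
  /-- `mem[reg a] := reg b` -/
  | store (a b : ℕ)
  /-- `reg d :=` the next bit of the random tape -/
  | bit (d : ℕ)
  /-- `reg d :=` degree of node `reg v` -/
  | deg (d v : ℕ)
  /-- `reg d :=` neighbour number `reg i` of node `reg v` -/
  | nbr (d v i : ℕ)
  /-- `reg d :=` entry `(reg u, reg v)` of the adjacency matrix -/
  | adj (d u v : ℕ)

/-- Programs. A test on register `r` is the test `reg r ≠ 0`. -/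
inductive Prog
  | skip
  | instr (i : Instr)
  | seq (p q : Prog)
  | ite (r : ℕ) (p q : Prog)
  | loop (r : ℕ) (p : Prog)

/-- Registers, memory, and the number of bits of the random tape read so far. -/
structure State where
  reg : ℕ → ℕ
  mem : ℕ → ℕ
  pos : ℕ

/-- The state `s` with register `d` set to `x`. -/
def State.set (s : State) (d x : ℕ) : State :=
  { s with reg := Function.update s.reg d x }

/-- The effect of an instruction, on input graph `I` and random tape `ω`. -/
noncomputable def Instr.exec {n : ℕ} (I : GraphInput n) (ω : ℕ → Bool) : Instr → State → State
  | .const d k, s => s.set d k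
  | .op o d a b, s => s.set d (o.eval (s.reg a) (s.reg b))
  | .load d a, s => s.set d (s.mem (s.reg a))
  | .store a b, s => { s with mem := Function.update s.mem (s.reg a) (s.reg b) }
  | .bit d, s => { s.set d (ω s.pos).toNat with pos := s.pos + 1 }
  | .deg d v, s => s.set d (I.degAt (s.reg v))
  | .nbr d v i, s => s.set d (I.nbrAt (s.reg v) (s.reg i))
  | .adj d u v, s => s.set d (I.adjAt (s.reg u) (s.reg v))

/-- The cost of an instruction: one plus the number of binary digits of the numbers it handles. -/
def Instr.cost {n : ℕ} (I : GraphInput n) : Instr → State → ℕ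
  | .const _ k, _ => 1 + k.size
  | .op _ _ a b, s => 1 + (s.reg a).size + (s.reg b).size
  | .load _ a, s => 1 + (s.reg a).size + (s.mem (s.reg a)).size
  | .store a b, s => 1 + (s.reg a).size + (s.reg b).size
  | .bit _, _ => 1
  | .deg _ v, s => 1 + (s.reg v).size + (I.degAt (s.reg v)).size
  | .nbr _ v i, s => 1 + (s.reg v).size + (s.reg i).size + (I.nbrAt (s.reg v) (s.reg i)).size
  | .adj _ u v, s => 1 + (s.reg u).size + (s.reg v).size

/-- `Exec I ω p s t s'`: on input graph `I` and random tape `ω`, the program `p` started in state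
`s` halts in state `s'` after time `t`. -/
inductive Exec {n : ℕ} (I : GraphInput n) (ω : ℕ → Bool) : Prog → State → ℕ → State → Prop
  | skip (s : State) : Exec I ω .skip s 0 s
  | instr (i : Instr) (s : State) : Exec I ω (.instr i) s (i.cost I s) (i.exec I ω s)
  | seq {p q : Prog} {s₁ s₂ s₃ : State} {t₁ t₂ : ℕ} :
      Exec I ω p s₁ t₁ s₂ → Exec I ω q s₂ t₂ s₃ → Exec I ω (.seq p q) s₁ (t₁ + t₂) s₃
  | iteTrue {r : ℕ} {p q : Prog} {s s' : State} {t : ℕ} : s.reg r ≠ 0 →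
      Exec I ω p s t s' → Exec I ω (.ite r p q) s (1 + (s.reg r).size + t) s'
  | iteFalse {r : ℕ} {p q : Prog} {s s' : State} {t : ℕ} : s.reg r = 0 →
      Exec I ω q s t s' → Exec I ω (.ite r p q) s (1 + t) s'
  | loopStop {r : ℕ} {p : Prog} {s : State} : s.reg r = 0 →
      Exec I ω (.loop r p) s 1 s
  | loopStep {r : ℕ} {p : Prog} {s₁ s₂ s₃ : State} {t₁ t₂ : ℕ} : s₁.reg r ≠ 0 →
      Exec I ω p s₁ t₁ s₂ → Exec I ω (.loop r p) s₂ t₂ s₃ →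
      Exec I ω (.loop r p) s₁ (1 + (s₁.reg r).size + t₁ + t₂) s₃

/-! ### Local computation algorithms -/

/-- The state in which every query `(u, v)` is started: registers `0, 1, 2, 3` hold `n`, `⌈1/ε⌉`,
`u`, `v`, all other registers and the memory are `0`, and the random tape is at its beginning. -/
noncomputable def initState {n : ℕ} (ε : ℝ) (u v : Fin n) : State where
  reg := fun
    | 0 => n
    | 1 => ⌈1 / ε⌉₊
    | 2 => u
    | 3 => v
    | _ => 0
  mem := fun _ => 0
  pos := 0

/-- On input `I`, parameter `ε` and random tape `ω`, the program halts on query `(u, v)` within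
time `T`. -/
def HaltsWithin {n : ℕ} (P : Prog) (I : GraphInput n) (ε : ℝ) (ω : ℕ → Bool) (u v : Fin n)
    (T : ℝ) : Prop :=
  ∃ (t : ℕ) (s : State), Exec I ω P (initState ε u v) t s ∧ (t : ℝ) ≤ T

/-- The program answers YES to the query `(u, v)`: it halts with a nonzero register `0`. -/
def SaysYes {n : ℕ} (P : Prog) (I : GraphInput n) (ε : ℝ) (ω : ℕ → Bool) (u v : Fin n) : Prop :=
  ∃ (t : ℕ) (s : State), Exec I ω P (initState ε u v) t s ∧ s.reg 0 ≠ 0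

/-- The random tape `ω` is good: the edges of the input graph to which the program says YES, when
all queries use `ω`, form a solution of Sparse Spanning Subgraph. -/
def SolvesSSS {n : ℕ} (P : Prog) (I : GraphInput n) (ε : ℝ) (ω : ℕ → Bool) : Prop :=
  ∃ H : SimpleGraph (Fin n), IsSSS I.graph ε H ∧
    ∀ u v, I.graph.Adj u v → (SaysYes P I ε ω u v ↔ H.Adj u v)

/-- The law of an infinite tape of independent fair random bits. -/
noncomputable def tapeMeasure : MeasureTheory.Measure (ℕ → Bool) :=
  MeasureTheory.Measure.infinitePi fun _ => (PMF.uniformOfFintype Bool).toMeasure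

/-- `P` is a local computation algorithm for Sparse Spanning Subgraph, for all `0 < ε < 1` and all
input graphs, with query time `T n ε` (for every query and every random tape), and with success
probability at least `1 - δ n` over the random tape shared by all queries. -/
def IsLCAForSSS (P : Prog) (T : ℕ → ℝ → ℝ) (δ : ℕ → ℝ) : Prop :=
  ∀ (n : ℕ) (I : GraphInput n) (ε : ℝ), 0 < ε → ε < 1 →
    (∀ (ω : ℕ → Bool) (u v : Fin n), I.graph.Adj u v → HaltsWithin P I ε ω u v (T n ε)) ∧
    ENNReal.ofReal (1 - δ n) ≤ tapeMeasure {ω | SolvesSSS P I ε ω}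

end SSSLocal

/-! Every query recomputes the same forest `F` of the input graph from the shared tape and says YES
if the queried edge lies in `F` or joins two components of `F`. For every tape this preserves
connectivity, because an omitted edge has both ends in one component of `F`. As `F` has at most `n -
1` edges, it remains to bound the crossing edges by `n / q`, where `q = min ⌈1/ε⌉ n`
(`isSSS_sparseSubgraph`).

The forest grows in two stages. The first is deterministic and makes the component of each node `v`
have at least `deg v / 2` nodes (`degree_le_two_mul_compSize`). For falling thresholds `T`, an
uncovered node of degree at least `T` is joined to `T` neighbours, but the scan stops at the first
covered one, whose component already has more than `T` nodes. Every step of a scan except possibly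
the last covers a new node, so all scans together need only `O(n)` unions. In the second stage each
node samples `k = 8 (c + 2) q L²` random neighbours, with `L = n.size`.

The crossing edges are counted by a union bound. Classify them by the size, between `2^j` and
`2^(j+1)`, of the smaller first-stage component at their ends. At most `n / 2^j` components have
`2^j` or more nodes, so they have at most `exp (L n / 2^j)` labellings by nodes. The components of
`F` induce such a labelling, and no sample joins different labels (`exists_labelling`). Fix instead
a labelling with more than `n / (L q)` cut edges in class `j`: nodes of this class have degree below
`4 * 2^j`, so all samples avoid the cut with probability at most `exp (-(c + 2) L n / 2^j)`
(`tapeMeasure_avoiding_cutNumbers_le`). This outweighs the number of labellings, and summing over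
the `L` classes leaves at most `n^(-c)` (`le_tapeMeasure_crossing_le`).

For the running time, union by size makes each search logarithmic, and there are `O(n + n k)`
unions. Once `⌈1/ε⌉` is capped by `n`, all numbers are polynomial in `n`, so a step costs `O(log
n)`. The rules for `Halts` yield time and correctness together (`exec_sssProg`). -/

namespace SSSLocal

/-! ### Growing a forest edge by edge -/

section Forest

variable {V : Type*}

open Classical in
/-- The graph `F` together with the edge `x y` if this edge joins two components of `F`. -/
noncomputable def addEdge (F : SimpleGraph V) (x y : V) : SimpleGraph V :=
  if F.Reachable x y then F else F ⊔ SimpleGraph.edge x y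

theorem addEdge_of_reachable {F : SimpleGraph V} {x y : V} (h : F.Reachable x y) :
    addEdge F x y = F := if_pos h

theorem addEdge_of_not_reachable {F : SimpleGraph V} {x y : V} (h : ¬F.Reachable x y) :
    addEdge F x y = F ⊔ SimpleGraph.edge x y := if_neg h

theorem le_addEdge (F : SimpleGraph V) (x y : V) : F ≤ addEdge F x y := by
  unfold addEdge
  split_ifs
  exacts [le_rfl, le_sup_left]

theorem addEdge_reachable (F : SimpleGraph V) (x y : V) : (addEdge F x y).Reachable x y := by
  unfold addEdge
  split_ifs with h
  · exact h
  · have hne : x ≠ y := fun e => h (e ▸ .refl x)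
    exact SimpleGraph.Adj.reachable (by simp [SimpleGraph.edge_adj, hne])

theorem addEdge_isAcyclic {F : SimpleGraph V} (hF : F.IsAcyclic) (x y : V) :
    (addEdge F x y).IsAcyclic := by
  unfold addEdge
  split_ifs with h
  exacts [hF, hF.sup_edge_of_not_reachable h]

theorem addEdge_le {F G : SimpleGraph V} (hF : F ≤ G) {x y : V} (h : x = y ∨ G.Adj x y) :
    addEdge F x y ≤ G := by
  unfold addEdge
  split_ifs
  exacts [hF, sup_le hF ((SimpleGraph.edge_le_iff G).2 h)]

/-- A walk needs the new edge at most once, in one of its two directions. -/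
theorem reachable_sup_edge_iff (F : SimpleGraph V) (x y a b : V) :
    (F ⊔ SimpleGraph.edge x y).Reachable a b ↔ F.Reachable a b ∨
      (F.Reachable a x ∧ F.Reachable y b) ∨ (F.Reachable a y ∧ F.Reachable x b) := by
  constructor
  · rintro ⟨p⟩
    induction p with
    | nil => exact .inl (.refl _)
    | @cons a c b h _ ih =>
      rw [SimpleGraph.sup_adj, SimpleGraph.edge_adj] at h
      rcases h with h | ⟨⟨rfl, rfl⟩ | ⟨rfl, rfl⟩, -⟩
      · have hr := h.reachable
        rcases ih with h1 | ⟨h1, h2⟩ | ⟨h1, h2⟩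
        · exact .inl (hr.trans h1)
        · exact .inr (.inl ⟨hr.trans h1, h2⟩)
        · exact .inr (.inr ⟨hr.trans h1, h2⟩)
      · rcases ih with h1 | ⟨h1, h2⟩ | ⟨h1, h2⟩
        · exact .inr (.inl ⟨.refl _, h1⟩)
        · exact .inr (.inl ⟨.refl _, h2⟩)
        · exact .inl h2
      · rcases ih with h1 | ⟨h1, h2⟩ | ⟨h1, h2⟩
        · exact .inr (.inr ⟨.refl _, h1⟩)
        · exact .inl h2
        · exact .inr (.inr ⟨.refl _, h2⟩)
  · have hxy : (F ⊔ SimpleGraph.edge x y).Reachable x y := by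
      by_cases e : x = y
      · subst e; exact .refl _
      · exact SimpleGraph.Adj.reachable (by simp [SimpleGraph.edge_adj, e])
    have hle : F ≤ F ⊔ SimpleGraph.edge x y := le_sup_left
    rintro (h | ⟨h1, h2⟩ | ⟨h1, h2⟩)
    · exact h.mono hle
    · exact (h1.mono hle).trans (hxy.trans (h2.mono hle))
    · exact (h1.mono hle).trans (hxy.symm.trans (h2.mono hle))

/-- The number of nodes in the component of `v`. -/
noncomputable def compSize (F : SimpleGraph V) (v : V) : ℕ := {w | F.Reachable v w}.ncard

theorem compSize_congr {F : SimpleGraph V} {v w : V} (h : F.Reachable v w) :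
    compSize F v = compSize F w := by
  unfold compSize
  congr 1
  ext x
  exact ⟨h.symm.trans, h.trans⟩

theorem compSize_mono [Finite V] {F F' : SimpleGraph V} (h : F ≤ F') (v : V) :
    compSize F v ≤ compSize F' v :=
  Set.ncard_le_ncard fun _ hw => SimpleGraph.Reachable.mono h hw

theorem compSize_pos [Finite V] (F : SimpleGraph V) (v : V) : 0 < compSize F v :=
  (Set.ncard_pos).2 ⟨v, .refl v⟩

theorem compSize_le_card {n : ℕ} (F : SimpleGraph (Fin n)) (v : Fin n) : compSize F v ≤ n := by
  simpa [compSize] using Set.ncard_le_card {w | F.Reachable v w}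

/-- A forest extends to a spanning tree of the complete graph. The strictness matters: the spare
edge later pays for capping `q` by `n`. -/
theorem ncard_edgeSet_lt_of_isAcyclic {n : ℕ} (hn : 0 < n) {F : SimpleGraph (Fin n)}
    (hF : F.IsAcyclic) : F.edgeSet.ncard < n := by
  classical
  have : Nonempty (Fin n) := ⟨⟨0, hn⟩⟩
  obtain ⟨T, hFT, -, hT⟩ :=
    (SimpleGraph.connected_top (V := Fin n)).exists_isTree_le_of_le_of_isAcyclic le_top hF
  have h1 := hT.card_edgeFinset
  have h2 : F.edgeSet.ncard ≤ T.edgeSet.ncard :=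
    Set.ncard_le_ncard (SimpleGraph.edgeSet_mono hFT)
  rw [← SimpleGraph.coe_edgeFinset T, Set.ncard_coe_finset] at h2
  simp at h1
  omega

end Forest

/-! ### The global forest -/

namespace GraphInput

variable {n : ℕ} (I : GraphInput n)

/-- The degree of the node `v`. -/
def degree (v : Fin n) : ℕ := (I.nbrs v).length

/-- The neighbour number `i` of the node `v`, and `v` itself if there is no such neighbour. -/
def neighbor (v : Fin n) (i : ℕ) : Fin n := (I.nbrs v)[i]?.getD v

theorem degAt_val (v : Fin n) : I.degAt v = I.degree v := by simp [degAt, degree]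

theorem nbrAt_val {v : Fin n} {i : ℕ} (h : i < I.degree v) : I.nbrAt v i = I.neighbor v i := by
  unfold degree at h
  simp [nbrAt, neighbor, h]

theorem adj_neighbor {v : Fin n} {i : ℕ} (h : i < I.degree v) :
    I.graph.Adj v (I.neighbor v i) := by
  unfold degree at h
  rw [← I.mem_nbrs]
  simp [neighbor, h]

theorem neighbor_of_le {v : Fin n} {i : ℕ} (h : I.degree v ≤ i) : I.neighbor v i = v := by
  unfold degree at h
  simp [neighbor, h]

/-- The default value makes an invalid number harmless, since `addEdge` from `v` to itself changes
nothing. -/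
theorem eq_or_adj_neighbor (v : Fin n) (i : ℕ) :
    v = I.neighbor v i ∨ I.graph.Adj v (I.neighbor v i) := by
  rcases lt_or_ge i (I.degree v) with h | h
  exacts [.inr (I.adj_neighbor h), .inl (I.neighbor_of_le h).symm]

theorem neighbor_inj {v : Fin n} {i j : ℕ} (hi : i < I.degree v) (hj : j < I.degree v)
    (h : I.neighbor v i = I.neighbor v j) : i = j := by
  unfold degree at hi hj
  have := I.nodup v
  simp only [neighbor, List.getElem?_eq_getElem hi, List.getElem?_eq_getElem hj,
    Option.getD_some] at h
  exact (List.Nodup.getElem_inj_iff this).1 h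

theorem exists_neighbor_eq {v w : Fin n} (h : I.graph.Adj v w) :
    ∃ i < I.degree v, I.neighbor v i = w := by
  rw [← I.mem_nbrs, List.mem_iff_getElem] at h
  obtain ⟨i, hi, rfl⟩ := h
  exact ⟨i, hi, by simp [neighbor, hi]⟩

theorem degree_lt (v : Fin n) : I.degree v < n := by
  have h1 : (v :: I.nbrs v).Nodup :=
    List.nodup_cons.2 ⟨fun h => I.graph.loopless.irrefl v ((I.mem_nbrs v v).1 h), I.nodup v⟩
  simpa [degree] using h1.length_le_card

/-- Join `v` to its neighbours with the numbers `g - 1, …, 0`, stopping at the first one that is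
already covered; the nodes reached become covered. -/
noncomputable def scan (v : Fin n) :
    ℕ → Finset (Fin n) × SimpleGraph (Fin n) → Finset (Fin n) × SimpleGraph (Fin n)
  | 0, σ => σ
  | g + 1, σ =>
    if I.neighbor v g ∈ σ.1 then (σ.1, addEdge σ.2 v (I.neighbor v g))
    else scan v g (insert (I.neighbor v g) σ.1, addEdge σ.2 v (I.neighbor v g))

/-- Cover the node `v` by a scan, if it is uncovered and of degree at least `T`. -/
noncomputable def visit (T : ℕ) (v : Fin n) (σ : Finset (Fin n) × SimpleGraph (Fin n)) :
    Finset (Fin n) × SimpleGraph (Fin n) :=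
  if T ≤ I.degree v ∧ v ∉ σ.1 then I.scan v T (insert v σ.1, σ.2) else σ

/-- Visit the nodes `j - 1, …, 0`. -/
noncomputable def sweep (T : ℕ) :
    ℕ → Finset (Fin n) × SimpleGraph (Fin n) → Finset (Fin n) × SimpleGraph (Fin n)
  | 0, σ => σ
  | j + 1, σ => sweep T j (if h : j < n then I.visit T ⟨j, h⟩ σ else σ)

/-- The covered nodes and the forest after the sweeps with thresholds `n, n / 2, …, n / 2 ^ (i-1)`. -/
noncomputable def level : ℕ → Finset (Fin n) × SimpleGraph (Fin n)
  | 0 => (∅, ⊥)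
  | i + 1 => I.sweep (n / 2 ^ i) n (level i)

/-- A forest in which the component of each node `v` has at least `deg v / 2` nodes. -/
noncomputable def starForest : SimpleGraph (Fin n) := (I.level n.size).2

end GraphInput

/-- The number with the `l` binary digits `ω a, …, ω (a + l - 1)`. -/
def blockVal (ω : ℕ → Bool) (a : ℕ) : ℕ → ℕ
  | 0 => 0
  | l + 1 => 2 * blockVal ω a l + (ω (a + l)).toNat

namespace GraphInput

variable {n : ℕ} (I : GraphInput n)

/-- The forest after `j` of the random samples, when there are `k` samples for each node. -/
noncomputable def sampleForest (ω : ℕ → Bool) (k : ℕ) : ℕ → SimpleGraph (Fin n)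
  | 0 => I.starForest
  | j + 1 =>
    if h : (n * k - 1 - j) / k < n then
      addEdge (sampleForest ω k j) ⟨_, h⟩
        (I.neighbor ⟨_, h⟩ (blockVal ω (j * n.size) n.size % I.degree ⟨_, h⟩))
    else sampleForest ω k j

/-- All forests here arise by repeated `addEdge` towards a neighbour, so acyclicity and containment
in the input graph need checking for this operation only. -/
theorem scan_induction {P : SimpleGraph (Fin n) → Prop}
    (h : ∀ F v i, P F → P (addEdge F v (I.neighbor v i))) (v : Fin n) (g : ℕ)
    (σ : Finset (Fin n) × SimpleGraph (Fin n)) (hσ : P σ.2) : P (I.scan v g σ).2 := by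
  induction g generalizing σ with
  | zero => exact hσ
  | succ g ih =>
    rw [scan]
    split_ifs
    · exact h _ _ _ hσ
    · exact ih _ (h _ _ _ hσ)

theorem sweep_induction {P : SimpleGraph (Fin n) → Prop}
    (h : ∀ F v i, P F → P (addEdge F v (I.neighbor v i))) (T j : ℕ)
    (σ : Finset (Fin n) × SimpleGraph (Fin n)) (hσ : P σ.2) : P (I.sweep T j σ).2 := by
  induction j generalizing σ with
  | zero => exact hσ
  | succ j ih =>
    rw [sweep]
    refine ih _ ?_
    split_ifs
    · rw [visit]
      split_ifs
      exacts [I.scan_induction h _ _ _ hσ, hσ]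
    · exact hσ

theorem starForest_induction {P : SimpleGraph (Fin n) → Prop} (h0 : P ⊥)
    (h : ∀ F v i, P F → P (addEdge F v (I.neighbor v i))) : P I.starForest := by
  suffices H : ∀ i, P (I.level i).2 from H _
  intro i
  induction i with
  | zero => exact h0
  | succ i ih => exact I.sweep_induction h _ _ _ ih

theorem sampleForest_induction {P : SimpleGraph (Fin n) → Prop} (h0 : P I.starForest)
    (h : ∀ F v i, P F → P (addEdge F v (I.neighbor v i))) (ω : ℕ → Bool) (k j : ℕ) :
    P (I.sampleForest ω k j) := by
  induction j with
  | zero => exact h0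
  | succ j ih =>
    rw [sampleForest]
    split_ifs
    exacts [h _ _ _ ih, ih]

theorem sampleForest_isAcyclic (ω : ℕ → Bool) (k j : ℕ) : (I.sampleForest ω k j).IsAcyclic :=
  I.sampleForest_induction
    (I.starForest_induction SimpleGraph.isAcyclic_bot fun _ _ _ hF => addEdge_isAcyclic hF _ _)
    (fun _ _ _ hF => addEdge_isAcyclic hF _ _) ω k j

theorem sampleForest_le_graph (ω : ℕ → Bool) (k j : ℕ) : I.sampleForest ω k j ≤ I.graph :=
  I.sampleForest_induction (P := (· ≤ I.graph))
    (I.starForest_induction (P := (· ≤ I.graph)) bot_le fun _ _ _ hF => addEdge_le hF (I.eq_or_adj_neighbor _ _))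
    (fun _ _ _ hF => addEdge_le hF (I.eq_or_adj_neighbor _ _)) ω k j

theorem sampleForest_mono (ω : ℕ → Bool) (k : ℕ) : Monotone (I.sampleForest ω k) := by
  refine monotone_nat_of_le_succ fun j => ?_
  rw [sampleForest]
  split_ifs
  exacts [le_addEdge _ _ _, le_rfl]

theorem starForest_le_sampleForest (ω : ℕ → Bool) (k j : ℕ) :
    I.starForest ≤ I.sampleForest ω k j := I.sampleForest_mono ω k (Nat.zero_le j)

/-! ### Component sizes in the star forest -/

theorem le_scan (v : Fin n) (g : ℕ) (σ : Finset (Fin n) × SimpleGraph (Fin n)) :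
    σ.2 ≤ (I.scan v g σ).2 :=
  I.scan_induction (P := fun F => σ.2 ≤ F) (fun _ _ _ h => h.trans (le_addEdge _ _ _)) v g σ le_rfl

theorem subset_scan (v : Fin n) (g : ℕ) (σ : Finset (Fin n) × SimpleGraph (Fin n)) :
    σ.1 ⊆ (I.scan v g σ).1 := by
  induction g generalizing σ with
  | zero => exact subset_rfl
  | succ g ih =>
    rw [scan]
    split_ifs
    exacts [subset_rfl, (Finset.subset_insert _ _).trans (ih (_, _))]

theorem subset_visit (T : ℕ) (v : Fin n) (σ : Finset (Fin n) × SimpleGraph (Fin n)) :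
    σ.1 ⊆ (I.visit T v σ).1 := by
  rw [visit]
  split_ifs
  exacts [(Finset.subset_insert _ _).trans (I.subset_scan v T (_, _)), subset_rfl]

theorem le_visit (T : ℕ) (v : Fin n) (σ : Finset (Fin n) × SimpleGraph (Fin n)) :
    σ.2 ≤ (I.visit T v σ).2 := by
  rw [visit]
  split_ifs
  exacts [I.le_scan v T (insert v σ.1, σ.2), le_rfl]

theorem subset_sweep (T j : ℕ) (σ : Finset (Fin n) × SimpleGraph (Fin n)) :
    σ.1 ⊆ (I.sweep T j σ).1 := by
  induction j generalizing σ with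
  | zero => exact subset_rfl
  | succ j ih =>
    rw [sweep]
    refine subset_trans ?_ (ih _)
    split_ifs
    exacts [I.subset_visit _ _ _, subset_rfl]

theorem level_subset {i j : ℕ} (h : i ≤ j) : (I.level i).1 ⊆ (I.level j).1 :=
  monotone_nat_of_le_succ (f := fun i => (I.level i).1) (fun _ => I.subset_sweep _ _ _) h

/-- A scan that is not stopped puts `v` together with `T` distinct neighbours, which makes `T + 1`
nodes. A scan that stops has met a node of `cov`, the set covered before the visit, because the
neighbours of `v` are distinct and differ from `v`; the component of that node is already large, and
`v` has just joined it. The hypotheses describe a scan that has handled the numbers from `g` on. -/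
theorem lt_compSize_scan {v : Fin n} {T : ℕ} (hT : T ≤ I.degree v) (cov : Finset (Fin n))
    {g : ℕ} (hg : g ≤ T) (σ : Finset (Fin n) × SimpleGraph (Fin n))
    (h1 : ∀ w ∈ σ.1, w ∈ cov ∨ w = v ∨ ∃ i, g ≤ i ∧ i < T ∧ w = I.neighbor v i)
    (h2 : ∀ i, g ≤ i → i < T → σ.2.Reachable v (I.neighbor v i))
    (h3 : ∀ w ∈ cov, T < compSize σ.2 w) :
    ∀ w ∈ (I.scan v g σ).1, T < compSize (I.scan v g σ).2 w := by
  induction g generalizing σ with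
  | zero =>
    have hv : T < compSize σ.2 v := by
      have hinj : Set.InjOn (fun i => I.neighbor v i) (Finset.range T : Set ℕ) := by
        intro i hi j hj h
        simp only [Finset.coe_range, Set.mem_Iio] at hi hj
        exact I.neighbor_inj (hi.trans_le hT) (hj.trans_le hT) h
      have hmem : v ∉ (Finset.range T).image (I.neighbor v) := by
        simp only [Finset.mem_image, Finset.mem_range, not_exists, not_and]
        intro i hi h
        exact (I.adj_neighbor (hi.trans_le hT)).ne h.symm
      have hcard : (insert v ((Finset.range T).image (I.neighbor v))).card = T + 1 := by
        rw [Finset.card_insert_of_notMem hmem, Finset.card_image_of_injOn hinj, Finset.card_range]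
      have hsub : ((insert v ((Finset.range T).image (I.neighbor v)) : Finset (Fin n)) :
          Set (Fin n)) ⊆ {w | σ.2.Reachable v w} := by
        intro w hw
        simp only [Finset.coe_insert, Finset.coe_image, Finset.coe_range, Set.mem_insert_iff,
          Set.mem_image, Set.mem_Iio] at hw
        rcases hw with rfl | ⟨i, hi, rfl⟩
        exacts [.refl _, h2 i (Nat.zero_le _) hi]
      have := Set.ncard_le_ncard hsub
      rw [Set.ncard_coe_finset, hcard] at this
      exact this
    intro w hw
    rcases h1 w hw with h | rfl | ⟨i, hi, hiT, rfl⟩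
    · exact h3 w h
    · exact hv
    · exact (compSize_congr (h2 i hi hiT)) ▸ hv
  | succ g ih =>
    rw [scan]
    set w' := I.neighbor v g with hw'
    have hreach := addEdge_reachable σ.2 v w'
    have h2' : ∀ i, g ≤ i → i < T → (addEdge σ.2 v w').Reachable v (I.neighbor v i) := by
      intro i hi hiT
      rcases hi.eq_or_lt with rfl | hi
      · exact hreach
      · exact (h2 i hi hiT).mono (le_addEdge _ _ _)
    have h3' : ∀ w ∈ cov, T < compSize (addEdge σ.2 v w') w := fun w hw =>
      (h3 w hw).trans_le (compSize_mono (le_addEdge _ _ _) w)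
    split_ifs with hmem
    · have hcov : w' ∈ cov := by
        rcases h1 w' hmem with h | h | ⟨i, hi, hiT, h⟩
        · exact h
        · exact absurd h (I.adj_neighbor (hg.trans hT)).ne'
        · have := I.neighbor_inj (hg.trans hT) (hiT.trans_le hT) h
          omega
      have hv : T < compSize (addEdge σ.2 v w') v := compSize_congr hreach ▸ h3' w' hcov
      intro w hw
      rcases h1 w hw with h | rfl | ⟨i, hi, hiT, rfl⟩
      · exact h3' w h
      · exact hv
      · exact compSize_congr (h2' i (by omega) hiT) ▸ hv
    · refine ih (by omega) _ ?_ h2' h3'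
      intro w hw
      rcases Finset.mem_insert.1 hw with rfl | hw
      · exact .inr (.inr ⟨g, le_rfl, by omega, rfl⟩)
      · rcases h1 w hw with h | h | ⟨i, hi, hiT, h⟩
        exacts [.inl h, .inr (.inl h), .inr (.inr ⟨i, by omega, hiT, h⟩)]

/-- After the sweep with threshold `T`: the covered nodes are in large components, and the uncovered
ones have small degree. -/
structure IsLevel (T : ℕ) (σ : Finset (Fin n) × SimpleGraph (Fin n)) : Prop where
  lt_compSize : ∀ v ∈ σ.1, T < compSize σ.2 v
  degree_le : ∀ v ∈ σ.1, I.degree v ≤ 2 * compSize σ.2 v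
  degree_lt : ∀ v, v ∉ σ.1 → I.degree v < T

/-- A node covered in this sweep was uncovered before, so its degree is below `T`, while its
component now has more than `T / 2` nodes; hence the factor 2 in `degree_le`. Nodes are visited
downwards, and the invariant says that uncovered nodes from `j` on already have degree below `T /
2`. -/
theorem isLevel_sweep {T : ℕ} {σ : Finset (Fin n) × SimpleGraph (Fin n)} (h : I.IsLevel T σ) :
    I.IsLevel (T / 2) (I.sweep (T / 2) n σ) := by
  suffices H : ∀ j ≤ n, ∀ τ : Finset (Fin n) × SimpleGraph (Fin n),
      (∀ v ∈ τ.1, T / 2 < compSize τ.2 v) → (∀ v ∈ τ.1, I.degree v ≤ 2 * compSize τ.2 v) →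
      (∀ v, v ∉ τ.1 → I.degree v < T) → (∀ v, v ∉ τ.1 → j ≤ v.val → I.degree v < T / 2) →
      I.IsLevel (T / 2) (I.sweep (T / 2) j τ) from
    H n le_rfl σ (fun v hv => (Nat.div_le_self _ _).trans_lt (h.lt_compSize v hv)) h.degree_le
      h.degree_lt fun v _ hv => absurd v.2 (by omega)
  intro j
  induction j with
  | zero =>
    intro _ τ h1 h2 h3 h4
    exact ⟨h1, h2, fun v hv => h4 v hv (Nat.zero_le _)⟩
  | succ j ih =>
    intro hj τ h1 h2 h3 h4
    have hjn : j < n := hj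
    rw [sweep, dif_pos hjn]
    have hsub := I.subset_visit (T / 2) ⟨j, hjn⟩ τ
    have hle := I.le_visit (T / 2) ⟨j, hjn⟩ τ
    have h1' : ∀ v ∈ (I.visit (T / 2) ⟨j, hjn⟩ τ).1,
        T / 2 < compSize (I.visit (T / 2) ⟨j, hjn⟩ τ).2 v := by
      rw [visit]
      split_ifs with hc
      · refine I.lt_compSize_scan hc.1 τ.1 le_rfl _ ?_ (fun i hi hi' => absurd hi (by omega)) h1
        intro w hw
        rcases Finset.mem_insert.1 hw with h | h
        exacts [.inr (.inl h), .inl h]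
      · exact h1
    refine ih (by omega) _ h1' ?_ (fun v hv => h3 v fun hv' => hv (hsub hv')) ?_
    · intro v hv
      by_cases hv' : v ∈ τ.1
      · exact (h2 v hv').trans (Nat.mul_le_mul_left 2 (compSize_mono hle v))
      · have := h3 v hv'
        have := h1' v hv
        omega
    · intro v hv hjv
      rcases hjv.eq_or_lt with h | h
      · have hvj : v = ⟨j, hjn⟩ := Fin.ext h.symm
        subst hvj
        by_contra hc
        refine hv ?_
        rw [visit, if_pos ⟨not_lt.1 hc, fun hv' => hv (hsub hv')⟩]
        exact I.subset_scan _ _ _ (Finset.mem_insert_self _ _)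
      · exact h4 v (fun hv' => hv (hsub hv')) h

/-- The latest threshold `n / 2 ^ (i - 1)` is written as `2 * n / 2 ^ i`, which also makes sense for
`i = 0`, where nothing is covered yet. -/
theorem isLevel_level (i : ℕ) : I.IsLevel (2 * n / 2 ^ i) (I.level i) := by
  induction i with
  | zero =>
    refine ⟨by simp [level], by simp [level], fun v _ => ?_⟩
    have := I.degree_lt v
    rw [pow_zero, Nat.div_one]
    omega
  | succ i ih =>
    have := I.isLevel_sweep ih
    rw [Nat.div_div_eq_div_mul, ← pow_succ] at this
    rw [level]
    convert this using 2
    rw [pow_succ, mul_comm (2 ^ i) 2, Nat.mul_div_mul_left _ _ (by norm_num)]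

theorem degree_le_two_mul_compSize (v : Fin n) : I.degree v ≤ 2 * compSize I.starForest v := by
  have h := I.isLevel_level n.size
  by_cases hv : v ∈ (I.level n.size).1
  · exact h.degree_le v hv
  · have h1 := h.degree_lt v hv
    -- The final threshold is at most 1, so the nodes still uncovered are isolated.
    have h2 : 2 * n / 2 ^ n.size < 2 := by
      rw [Nat.div_lt_iff_lt_mul (by positivity)]
      have := Nat.lt_size_self n
      omega
    have := compSize_pos I.starForest v
    omega

/-- A sampled edge joins nodes of one component. -/
theorem sampleForest_reachable (ω : ℕ → Bool) {k : ℕ} (v : Fin n) {j : ℕ} (hj : j < n * k)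
    (hv : (n * k - 1 - j) / k = v) :
    (I.sampleForest ω k (n * k)).Reachable v
      (I.neighbor v (blockVal ω (j * n.size) n.size % I.degree v)) := by
  refine SimpleGraph.Reachable.mono (I.sampleForest_mono ω k (Nat.succ_le_of_lt hj)) ?_
  have h : (n * k - 1 - j) / k < n := hv ▸ v.2
  have e : (⟨(n * k - 1 - j) / k, h⟩ : Fin n) = v := Fin.ext hv
  rw [Nat.succ_eq_add_one, sampleForest, dif_pos h, e]
  exact addEdge_reachable _ _ _

end GraphInput

end SSSLocal

namespace SSSLocal

open MeasureTheory ProbabilityTheory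

/-! ### Blocks of random bits -/

instance : IsProbabilityMeasure tapeMeasure := by
  unfold tapeMeasure
  infer_instance

theorem blockVal_lt (ω : ℕ → Bool) (a l : ℕ) : blockVal ω a l < 2 ^ l := by
  induction l with
  | zero => simp [blockVal]
  | succ l ih =>
    have := Bool.toNat_le (ω (a + l))
    rw [blockVal, pow_succ]
    omega

theorem blockVal_congr {ω ω' : ℕ → Bool} {a l : ℕ} (h : ∀ i, a ≤ i → i < a + l → ω i = ω' i) :
    blockVal ω a l = blockVal ω' a l := by
  induction l with
  | zero => rfl
  | succ l ih =>
    rw [blockVal, blockVal, ih fun i h1 h2 => h i h1 (by omega),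
      h (a + l) (by omega) (by omega)]

theorem measurable_blockVal (a l : ℕ) : Measurable fun ω : ℕ → Bool => blockVal ω a l := by
  induction l with
  | zero => exact measurable_const
  | succ l ih =>
    exact (ih.const_mul 2).add ((measurable_from_top (f := Bool.toNat)).comp
      (measurable_pi_apply (a + l)))

/-- The value determines the bits of the block, so the event is a cylinder. The last bit is the
parity of `r`, and the earlier ones encode `r / 2`. -/
theorem setOf_blockVal_eq (a : ℕ) {l r : ℕ} (hr : r < 2 ^ l) :
    ∃ t : ℕ → Bool, {ω | blockVal ω a l = r} =
      Set.pi (Finset.Ico a (a + l) : Set ℕ) fun i => {t i} := by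
  induction l generalizing r with
  | zero =>
    refine ⟨fun _ => true, ?_⟩
    have : r = 0 := by simpa using hr
    simp [blockVal, this]
  | succ l ih =>
    obtain ⟨t, ht⟩ := ih (r := r / 2) (by rw [pow_succ] at hr; omega)
    refine ⟨fun i => if i = a + l then decide (r % 2 = 1) else t i, ?_⟩
    ext ω
    have h1 : blockVal ω a l = r / 2 ↔ ∀ i, a ≤ i → i < a + l → ω i = t i := by
      have := congrArg (ω ∈ ·) ht
      simpa [Set.mem_pi] using this
    have h2 : blockVal ω a (l + 1) = r ↔
        blockVal ω a l = r / 2 ∧ ω (a + l) = decide (r % 2 = 1) := by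
      rw [blockVal]
      cases ω (a + l)
      · simp only [Bool.toNat_false, Bool.false_eq, decide_eq_false_iff_not]; omega
      · simp only [Bool.toNat_true, Bool.true_eq, decide_eq_true_eq]; omega
    simp only [Set.mem_ofPred_eq, h2, h1, Set.mem_pi, Finset.coe_Ico, Set.mem_Ico,
      Set.mem_singleton_iff]
    constructor
    · rintro ⟨h3, h4⟩ i ⟨hi, hi'⟩
      split_ifs with e
      · rw [e, h4]
      · exact h3 i hi (by omega)
    · intro h
      refine ⟨fun i hi hi' => ?_, ?_⟩
      · have := h i ⟨hi, by omega⟩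
        rwa [if_neg (by omega)] at this
      · have := h (a + l) ⟨by omega, by omega⟩
        rwa [if_pos rfl] at this

theorem tapeMeasure_blockVal_eq (a : ℕ) {l r : ℕ} (hr : r < 2 ^ l) :
    tapeMeasure.real {ω | blockVal ω a l = r} = ((2 : ℝ) ^ l)⁻¹ := by
  obtain ⟨t, ht⟩ := setOf_blockVal_eq a hr
  have h := Measure.infinitePi_pi (μ := fun _ : ℕ => (PMF.uniformOfFintype Bool).toMeasure)
    (s := Finset.Ico a (a + l)) (t := fun i => {t i}) fun i _ => measurableSet_singleton _
  rw [ht, Measure.real, tapeMeasure, h]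
  simp

theorem tapeMeasure_blockVal_mem (a l : ℕ) {B : Finset ℕ} (hB : ∀ r ∈ B, r < 2 ^ l) :
    tapeMeasure.real {ω | blockVal ω a l ∈ B} = B.card * ((2 : ℝ) ^ l)⁻¹ := by
  have : {ω | blockVal ω a l ∈ B} = ⋃ r ∈ B, {ω | blockVal ω a l = r} := by
    ext ω
    simp
  rw [this, measureReal_biUnion_finset]
  · rw [Finset.sum_congr rfl fun r hr => tapeMeasure_blockVal_eq a (hB r hr)]
    simp
  · intro r _ r' _ hne
    exact Set.disjoint_left.2 fun ω h1 h2 => hne (h1.symm.trans h2)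
  · exact fun r _ => measurable_blockVal a l (measurableSet_singleton r)

/-- The first `N` blocks and the next one read disjoint sets of independent bits. -/
theorem tapeMeasure_inter_blockVal (l N : ℕ) (B : ℕ → Set ℕ) (A : Set ℕ) :
    tapeMeasure.real ({ω | ∀ j < N, blockVal ω (j * l) l ∈ B j} ∩
        {ω | blockVal ω (N * l) l ∈ A}) =
      tapeMeasure.real {ω | ∀ j < N, blockVal ω (j * l) l ∈ B j} *
        tapeMeasure.real {ω | blockVal ω (N * l) l ∈ A} := by
  classical
  let S := Finset.range (N * l)
  let T := Finset.Ico (N * l) (N * l + l)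
  have hST : Disjoint S T := by
    rw [Finset.disjoint_left]
    intro i hi hi'
    simp only [S, T, Finset.mem_range, Finset.mem_Ico] at hi hi'
    omega
  have hind : iIndepFun (fun (i : ℕ) (ω : ℕ → Bool) => ω i) tapeMeasure :=
    iIndepFun_infinitePi (X := fun _ b => b) fun _ => measurable_id
  have h := hind.indepFun_finset S T hST fun i => measurable_pi_apply i
  -- To express an event through finitely many bits, these are extended by `false` to a tape; the
  -- blocks concerned never read the added bits.
  let ext (U : Finset ℕ) (x : U → Bool) (i : ℕ) : Bool := if h : i ∈ U then x ⟨i, h⟩ else false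
  have hext : ∀ (U : Finset ℕ) (ω : ℕ → Bool) (i : ℕ), i ∈ U →
      ext U (fun i : U => ω i) i = ω i := fun U ω i hi => by simp [ext, hi]
  have h1 : {ω | ∀ j < N, blockVal ω (j * l) l ∈ B j} =
      (fun ω (i : S) => ω i) ⁻¹' {x | ∀ j < N, blockVal (ext S x) (j * l) l ∈ B j} := by
    ext ω
    simp only [Set.mem_ofPred_eq, Set.mem_preimage]
    refine forall₂_congr fun j hj => ?_
    rw [blockVal_congr (a := j * l) fun i _ hi => hext S ω i ?_]
    have : (j + 1) * l ≤ N * l := Nat.mul_le_mul_right l hj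
    simp only [S, Finset.mem_range]
    rw [Nat.succ_mul] at this
    omega
  have h2 : {ω | blockVal ω (N * l) l ∈ A} =
      (fun ω (i : T) => ω i) ⁻¹' {x | blockVal (ext T x) (N * l) l ∈ A} := by
    ext ω
    simp only [Set.mem_ofPred_eq, Set.mem_preimage]
    rw [blockVal_congr (a := N * l) fun i hi hi' => hext T ω i (Finset.mem_Ico.2 ⟨hi, hi'⟩)]
  rw [h1, h2, Measure.real, Measure.real, Measure.real, ← ENNReal.toReal_mul]
  congr 1
  exact h.measure_inter_preimage_eq_mul _ _ (Set.toFinite _).measurableSet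
    (Set.toFinite _).measurableSet

theorem tapeMeasure_forall_blockVal_notMem (l N : ℕ) (B : ℕ → Finset ℕ)
    (hB : ∀ j, ∀ r ∈ B j, r < 2 ^ l) :
    tapeMeasure.real {ω | ∀ j < N, blockVal ω (j * l) l ∉ B j} =
      ∏ j ∈ Finset.range N, (1 - (B j).card * ((2 : ℝ) ^ l)⁻¹) := by
  induction N with
  | zero => simp
  | succ N ih =>
    have h1 : {ω : ℕ → Bool | ∀ j < N + 1, blockVal ω (j * l) l ∉ B j} =
        {ω | ∀ j < N, blockVal ω (j * l) l ∈ ((B j : Set ℕ)ᶜ)} ∩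
          {ω | blockVal ω (N * l) l ∈ ((B N : Set ℕ)ᶜ)} := by
      ext ω
      simp only [Set.mem_ofPred_eq, Set.mem_inter_iff, Set.mem_compl_iff, Finset.mem_coe]
      exact Nat.forall_lt_succ_right
    have h2 : {ω : ℕ → Bool | blockVal ω (N * l) l ∈ ((B N : Set ℕ)ᶜ)} =
        {ω | blockVal ω (N * l) l ∈ B N}ᶜ := by
      ext ω
      simp
    rw [h1, tapeMeasure_inter_blockVal l N (fun j => (B j : Set ℕ)ᶜ), Finset.prod_range_succ, ← ih,
      h2, probReal_compl_eq_one_sub, tapeMeasure_blockVal_mem _ _ (hB N)]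
    · simp
    · exact measurable_blockVal _ _ (B N).measurableSet

/-- A uniform number below `M` is not uniform modulo `d`, but each residue has at least `M / d`
(rounded down) preimages, and for `d ≤ M` rounding loses at most a factor 2. -/
theorem le_card_filter_mod_mem {d M : ℕ} {C : Finset ℕ} (hC : ∀ c ∈ C, c < d) (hd : d ≤ M) :
    (C.card : ℝ) / (2 * d) ≤
      (((Finset.range M).filter fun r => r % d ∈ C).card : ℝ) * (M : ℝ)⁻¹ := by
  rcases Nat.eq_zero_or_pos d with rfl | hd0
  · simp; positivity
  have h1 : C.card * (M / d) ≤ ((Finset.range M).filter fun r => r % d ∈ C).card := by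
    rw [← Finset.card_range (M / d), ← Finset.card_product]
    refine Finset.card_le_card_of_injOn (fun p => p.1 + d * p.2) ?_ ?_
    · rintro ⟨c, t⟩ h
      simp only [Finset.coe_product, Set.mem_prod, Finset.mem_coe, Finset.mem_range] at h
      have hc := hC c h.1
      simp only [Finset.coe_filter, Finset.mem_range, Set.mem_ofPred_eq, Nat.add_mul_mod_self_left,
        Nat.mod_eq_of_lt hc, h.1, and_true]
      calc c + d * t < d + d * t := by omega
        _ = d * (t + 1) := by ring
        _ ≤ d * (M / d) := Nat.mul_le_mul_left d h.2
        _ ≤ M := Nat.mul_div_le M d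
    · rintro ⟨c, t⟩ h ⟨c', t'⟩ h' he
      simp only [Finset.coe_product, Set.mem_prod, Finset.mem_coe, Finset.mem_range] at h h'
      simp only at he
      have hc := hC c h.1
      have hc' := hC c' h'.1
      have e1 : c = c' := by
        have := congrArg (· % d) he
        simpa [Nat.mod_eq_of_lt hc, Nat.mod_eq_of_lt hc'] using this
      subst e1
      have : t = t' := Nat.eq_of_mul_eq_mul_left hd0 (by omega)
      rw [this]
  have h2 : M ≤ 2 * d * (M / d) := by
    have h3 := Nat.div_add_mod M d
    have h4 := Nat.mod_lt M hd0
    have h5 : 1 ≤ M / d := (Nat.one_le_div_iff hd0).2 hd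
    nlinarith
  have hM : (0 : ℝ) < M := by exact_mod_cast hd0.trans_le hd
  have hd' : (0 : ℝ) < d := by exact_mod_cast hd0
  have h1' : (C.card : ℝ) * ((M / d : ℕ) : ℝ) ≤
      ((Finset.range M).filter fun r => r % d ∈ C).card := by exact_mod_cast h1
  have h2' : (M : ℝ) ≤ 2 * d * ((M / d : ℕ) : ℝ) := by exact_mod_cast h2
  rw [← div_eq_mul_inv, div_le_div_iff₀ (by positivity) hM]
  calc (C.card : ℝ) * M ≤ C.card * (2 * d * ((M / d : ℕ) : ℝ)) := by gcongr
    _ = C.card * ((M / d : ℕ) : ℝ) * (2 * d) := by ring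
    _ ≤ _ := by gcongr

/-- The samples treat the nodes from last to first, `k` in a row for each. -/
theorem sum_range_mul_div {n k : ℕ} (g : ℕ → ℝ) :
    ∑ j ∈ Finset.range (n * k), g ((n * k - 1 - j) / k) = k * ∑ v ∈ Finset.range n, g v := by
  rcases Nat.eq_zero_or_pos k with rfl | hk
  · simp
  rw [Finset.sum_range_reflect (fun j => g (j / k))]
  induction n with
  | zero => simp
  | succ n ih =>
    rw [Nat.succ_mul, Finset.sum_range_add, ih, Finset.sum_range_succ, mul_add]
    congr 1
    have : ∀ x ∈ Finset.range k, g ((n * k + x) / k) = g n := by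
      intro x hx
      rw [mul_comm, Nat.mul_add_div hk, Nat.div_eq_of_lt (Finset.mem_range.1 hx), add_zero]
    rw [Finset.sum_congr rfl this]
    simp

/-! ### Avoiding prescribed neighbours in all samples -/

namespace GraphInput

variable {n : ℕ} (I : GraphInput n)

/-- The tapes for which no sample of a node `v` has its number in `C v`. -/
def avoiding (k : ℕ) (C : Fin n → Finset ℕ) : Set (ℕ → Bool) :=
  {ω | ∀ j < n * k, ∀ v : Fin n, (n * k - 1 - j) / k = v →
    blockVal ω (j * n.size) n.size % I.degree v ∉ C v}

theorem measurableSet_avoiding (k : ℕ) (C : Fin n → Finset ℕ) :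
    MeasurableSet (I.avoiding k C) := by
  unfold avoiding
  refine measurableSet_setOfPred.2 <| .forall fun j => .forall fun _ => .forall fun v => .forall fun _ => ?_
  exact measurableSet_setOfPred.1 (measurable_blockVal _ _
    (MeasurableSet.of_discrete (s := {r | r % I.degree v ∉ C v})))

/-- By independence the probability is a product of factors `1 - p`, each at most `exp (-p)`, and a
sample of `v` has `p` at least `|C v| / (2 deg v)`. -/
theorem tapeMeasure_avoiding_le (k : ℕ) (C : Fin n → Finset ℕ)
    (hC : ∀ v, ∀ i ∈ C v, i < I.degree v) :
    tapeMeasure.real (I.avoiding k C) ≤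
      Real.exp (-(k * ∑ v, ((C v).card : ℝ) / (2 * I.degree v))) := by
  let B (j : ℕ) : Finset ℕ :=
    if h : (n * k - 1 - j) / k < n then
      (Finset.range (2 ^ n.size)).filter fun r => r % I.degree ⟨_, h⟩ ∈ C ⟨_, h⟩
    else ∅
  have hsub : I.avoiding k C ⊆ {ω | ∀ j < n * k, blockVal ω (j * n.size) n.size ∉ B j} := by
    intro ω hω j hj hmem
    simp only [B] at hmem
    split_ifs at hmem with h
    · exact hω j hj ⟨_, h⟩ rfl (Finset.mem_filter.1 hmem).2
    · simp at hmem
  have hB : ∀ j, ∀ r ∈ B j, r < 2 ^ n.size := by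
    intro j r hr
    simp only [B] at hr
    split_ifs at hr with h
    · exact Finset.mem_range.1 (Finset.mem_filter.1 hr).1
    · simp at hr
  let g (v : ℕ) : ℝ := if h : v < n then ((C ⟨v, h⟩).card : ℝ) / (2 * I.degree ⟨v, h⟩) else 0
  have hg : ∀ j, g ((n * k - 1 - j) / k) ≤ (B j).card * ((2 : ℝ) ^ n.size)⁻¹ := by
    intro j
    simp only [B, g]
    split_ifs with h
    -- Blocks of `n.size` bits suffice here, since the degree is below `n < 2 ^ n.size`.
    · have := le_card_filter_mod_mem (hC ⟨_, h⟩)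
        ((I.degree_lt ⟨_, h⟩).le.trans (Nat.lt_size_self n).le)
      simpa using this
    · simp
  have hcard : ∀ j, (B j).card * ((2 : ℝ) ^ n.size)⁻¹ ≤ 1 := by
    intro j
    rw [← div_eq_mul_inv, div_le_one (by positivity)]
    have : (B j).card ≤ (Finset.range (2 ^ n.size)).card :=
      Finset.card_le_card fun r hr => Finset.mem_range.2 (hB j r hr)
    rw [Finset.card_range] at this
    exact_mod_cast this
  calc tapeMeasure.real (I.avoiding k C)
      ≤ tapeMeasure.real {ω | ∀ j < n * k, blockVal ω (j * n.size) n.size ∉ B j} :=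
        measureReal_mono hsub
    _ = ∏ j ∈ Finset.range (n * k), (1 - (B j).card * ((2 : ℝ) ^ n.size)⁻¹) :=
        tapeMeasure_forall_blockVal_notMem _ _ B hB
    _ ≤ ∏ j ∈ Finset.range (n * k), Real.exp (-g ((n * k - 1 - j) / k)) := by
        refine Finset.prod_le_prod (fun j _ => sub_nonneg.2 (hcard j)) fun j _ => ?_
        refine le_trans ?_ (Real.add_one_le_exp _)
        linarith [hg j]
    _ = Real.exp (-(k * ∑ v, ((C v).card : ℝ) / (2 * I.degree v))) := by
        rw [← Real.exp_sum, Finset.sum_neg_distrib, sum_range_mul_div, ← Fin.sum_univ_eq_sum_range]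
        simp [g]

end GraphInput

end SSSLocal

namespace SSSLocal

open MeasureTheory ProbabilityTheory

namespace GraphInput

variable {n : ℕ} (I : GraphInput n)

/-! ### Few edges join different components of the sampled forest -/

/-- A fixed node in the component of `v` in the star forest. -/
noncomputable def center (v : Fin n) : Fin n := (I.starForest.connectedComponentMk v).out

theorem center_reachable (v : Fin n) : I.starForest.Reachable (I.center v) v :=
  SimpleGraph.ConnectedComponent.exact (Quot.out_eq (I.starForest.connectedComponentMk v))

theorem center_eq {v w : Fin n} (h : I.starForest.Reachable v w) : I.center v = I.center w := by
  unfold center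
  rw [SimpleGraph.ConnectedComponent.sound h]

/-- The centers of the components with at least `2 ^ j` nodes. -/
noncomputable def bigCenters (j : ℕ) : Finset (Fin n) :=
  (Finset.univ.filter fun v => 2 ^ j ≤ compSize I.starForest v).image I.center

theorem center_mem_bigCenters {j : ℕ} {v : Fin n} (h : 2 ^ j ≤ compSize I.starForest v) :
    I.center v ∈ I.bigCenters j :=
  Finset.mem_image_of_mem _ (Finset.mem_filter.2 ⟨Finset.mem_univ _, h⟩)

/-- The fibre of `center` over such a center is a whole component, hence has at least `2 ^ j` nodes.
-/
theorem two_pow_mul_card_bigCenters_le (j : ℕ) : 2 ^ j * (I.bigCenters j).card ≤ n := by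
  classical
  set s := Finset.univ.filter fun v => 2 ^ j ≤ compSize I.starForest v with hs
  have h := Finset.mul_card_image_le_card (f := I.center) s (2 ^ j) ?_
  · exact h.trans ((Finset.card_le_univ _).trans (by simp))
  · intro c hc
    obtain ⟨v, hv, rfl⟩ := Finset.mem_image.1 hc
    have hv' := (Finset.mem_filter.1 hv).2
    refine hv'.trans ?_
    rw [compSize, ← Set.ncard_coe_finset]
    refine Set.ncard_le_ncard fun w hw => ?_
    have hw : I.starForest.Reachable v w := hw
    simp only [hs, Finset.coe_filter, Finset.mem_filter, Finset.mem_univ, true_and]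
    exact ⟨compSize_congr hw ▸ hv', (I.center_eq hw).symm⟩

/-- The label of the component of `v`, for a labelling of the large components. -/
noncomputable def label (j : ℕ) (f : I.bigCenters j → Fin n) (v : Fin n) : Fin n :=
  if h : I.center v ∈ I.bigCenters j then f ⟨_, h⟩ else v

open Classical in
/-- The numbers of the neighbours of `v` in components at least as large as that of `v` that carry
another label, if the size of the component of `v` is between `2 ^ j` and `2 ^ (j + 1)`. -/
noncomputable def cutNumbers (j : ℕ) (f : I.bigCenters j → Fin n) (v : Fin n) : Finset ℕ :=
  (Finset.range (I.degree v)).filter fun i => Nat.log 2 (compSize I.starForest v) = j ∧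
    compSize I.starForest v ≤ compSize I.starForest (I.neighbor v i) ∧
    I.label j f v ≠ I.label j f (I.neighbor v i)

theorem two_pow_le_of_log_eq {j : ℕ} {v : Fin n}
    (h : Nat.log 2 (compSize I.starForest v) = j) : 2 ^ j ≤ compSize I.starForest v :=
  h ▸ Nat.pow_log_le_self 2 (compSize_pos _ _).ne'

/-- If the cut set is nonempty, the component of `v` has fewer than `2 ^ (j + 1)` nodes, so the
degree of `v` is below `4 * 2 ^ j`. -/
theorem card_cutNumbers_div_le (j : ℕ) (f : I.bigCenters j → Fin n) (v : Fin n) :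
    ((I.cutNumbers j f v).card : ℝ) / (8 * 2 ^ j) ≤
      ((I.cutNumbers j f v).card : ℝ) / (2 * I.degree v) := by
  rcases (I.cutNumbers j f v).eq_empty_or_nonempty with h | ⟨i, hi⟩
  · simp [h]
  simp only [cutNumbers, Finset.mem_filter, Finset.mem_range] at hi
  have h1 := I.degree_le_two_mul_compSize v
  have h2 : compSize I.starForest v < 2 ^ (j + 1) := by
    rw [← hi.2.1]
    exact Nat.lt_pow_succ_log_self (by norm_num) _
  have h3 : 2 * I.degree v ≤ 8 * 2 ^ j := by
    rw [pow_succ] at h2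
    omega
  have h4 : 0 < I.degree v := by omega
  exact div_le_div_of_nonneg_left (by positivity) (by positivity) (by exact_mod_cast h3)

/-- The edges of the graph that join different components of the final forest. -/
def crossing (ω : ℕ → Bool) (k : ℕ) : Set (Sym2 (Fin n)) :=
  {e ∈ I.graph.edgeSet | ∀ u v, e = s(u, v) → ¬(I.sampleForest ω k (n * k)).Reachable u v}

/-- Label each large component by a representative of its component in the final forest. Sampled
edges stay within final components, so no sample lies in a cut. Read a crossing edge from the end
with the smaller star component and let `j` be the binary logarithm of that size: both ends then lie
in components with at least `2 ^ j` nodes, where labels come from `f` rather than from the default,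
so the edge is counted in the cut for `j`. -/
theorem exists_labelling (ω : ℕ → Bool) (k : ℕ) :
    ∃ f : ∀ j, I.bigCenters j → Fin n,
      (∀ j, ω ∈ I.avoiding k (I.cutNumbers j (f j))) ∧
      (I.crossing ω k).ncard ≤
        ∑ j ∈ Finset.range n.size, ∑ v, (I.cutNumbers j (f j) v).card := by
  classical
  set F := I.sampleForest ω k (n * k) with hF
  have hle : I.starForest ≤ F := I.starForest_le_sampleForest ω k _
  let f (j : ℕ) (c : I.bigCenters j) : Fin n := (F.connectedComponentMk c.1).out
  have hf : ∀ j v, 2 ^ j ≤ compSize I.starForest v →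
      I.label j (f j) v = (F.connectedComponentMk v).out := by
    intro j v hv
    rw [label, dif_pos (I.center_mem_bigCenters hv)]
    simp only [f]
    rw [SimpleGraph.ConnectedComponent.sound ((I.center_reachable v).mono hle)]
  have hlab : ∀ j v w, 2 ^ j ≤ compSize I.starForest v → 2 ^ j ≤ compSize I.starForest w →
      (I.label j (f j) v = I.label j (f j) w ↔ F.Reachable v w) := by
    intro j v w hv hw
    rw [hf j v hv, hf j w hw]
    refine ⟨fun h => ?_, fun h => by rw [SimpleGraph.ConnectedComponent.sound h]⟩
    have h1 : ∀ x, F.Reachable (F.connectedComponentMk x).out x := fun x =>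
      SimpleGraph.ConnectedComponent.exact (Quot.out_eq (F.connectedComponentMk x))
    exact (h ▸ h1 v).symm.trans (h1 w)
  refine ⟨f, fun j => ?_, ?_⟩
  · intro i hi v hv hmem
    simp only [cutNumbers, Finset.mem_filter, Finset.mem_range] at hmem
    have h1 := I.two_pow_le_of_log_eq hmem.2.1
    exact hmem.2.2.2 ((hlab j v _ h1 (h1.trans hmem.2.2.1)).2 (I.sampleForest_reachable ω v hi hv))
  · let P (v : Fin n) : Finset ℕ := (Finset.range (I.degree v)).filter fun i =>
      compSize I.starForest v ≤ compSize I.starForest (I.neighbor v i) ∧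
        ¬F.Reachable v (I.neighbor v i)
    have h1 : I.crossing ω k ⊆
        ((Finset.univ.sigma P).image fun p => s(p.1, I.neighbor p.1 p.2) : Finset _) := by
      intro e he
      induction e with
      | h u v =>
        obtain ⟨hadj, hcr⟩ := he
        rw [SimpleGraph.mem_edgeSet] at hadj
        have hcr := hcr u v rfl
        simp only [Finset.coe_image, Set.mem_image, Finset.mem_coe, Finset.mem_sigma,
          Finset.mem_univ, true_and, Sigma.exists, P, Finset.mem_filter, Finset.mem_range]
        rcases le_total (compSize I.starForest u) (compSize I.starForest v) with h | h
        · obtain ⟨i, hi, rfl⟩ := I.exists_neighbor_eq hadj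
          exact ⟨u, i, ⟨hi, h, hcr⟩, rfl⟩
        · obtain ⟨i, hi, rfl⟩ := I.exists_neighbor_eq hadj.symm
          exact ⟨v, i, ⟨hi, h, fun h' => hcr h'.symm⟩, Sym2.eq_swap⟩
    have h2 : (I.crossing ω k).ncard ≤ ∑ v, (P v).card := by
      refine (Set.ncard_le_ncard h1).trans ?_
      rw [Set.ncard_coe_finset]
      exact Finset.card_image_le.trans (Finset.card_sigma _ _).le
    refine h2.trans ?_
    rw [Finset.sum_comm]
    refine Finset.sum_le_sum fun v _ => ?_
    set j := Nat.log 2 (compSize I.starForest v) with hj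
    have hjn : j ∈ Finset.range n.size := by
      rw [Finset.mem_range]
      exact Nat.log_lt_of_lt_pow (compSize_pos _ _).ne'
        ((compSize_le_card _ v).trans_lt (Nat.lt_size_self n))
    have h3 : P v ⊆ I.cutNumbers j (f j) v := by
      intro i hi
      simp only [P, Finset.mem_filter, Finset.mem_range] at hi
      simp only [cutNumbers, Finset.mem_filter, Finset.mem_range]
      have h1 := I.two_pow_le_of_log_eq hj.symm
      exact ⟨hi.1, rfl, hi.2.1, fun h => hi.2.2 ((hlab j v _ h1 (h1.trans hi.2.1)).1 h)⟩
    exact (Finset.card_le_card h3).trans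
      (Finset.single_le_sum (f := fun j => (I.cutNumbers j (f j) v).card)
        (fun _ _ => Nat.zero_le _) hjn)

theorem natCast_le_exp_size (n : ℕ) : (n : ℝ) ≤ Real.exp n.size := by
  have h1 : (n : ℝ) ≤ 2 ^ n.size := by exact_mod_cast (Nat.lt_size_self n).le
  refine h1.trans ?_
  rw [← mul_one (n.size : ℝ), Real.exp_nat_mul]
  gcongr
  have := Real.add_one_le_exp 1
  linarith

/-- Labellings whose cut is too large are unlikely to be avoided by the samples. -/
theorem tapeMeasure_avoiding_cutNumbers_le {c q j : ℕ}
    (f : I.bigCenters j → Fin n)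
    (hf : n < n.size * q * ∑ v, (I.cutNumbers j f v).card) :
    tapeMeasure.real (I.avoiding (8 * (c + 2) * q * n.size ^ 2) (I.cutNumbers j f)) ≤
      Real.exp (-((c + 2) * n.size * (n / 2 ^ j : ℝ))) := by
  refine (I.tapeMeasure_avoiding_le _ _ ?_).trans ?_
  · intro v i hi
    exact Finset.mem_range.1 (Finset.mem_filter.1 hi).1
  refine Real.exp_le_exp.2 (neg_le_neg ?_)
  have h1 : (∑ v, ((I.cutNumbers j f v).card : ℝ)) / (8 * 2 ^ j) ≤
      ∑ v, ((I.cutNumbers j f v).card : ℝ) / (2 * I.degree v) := by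
    rw [Finset.sum_div]
    exact Finset.sum_le_sum fun v _ => I.card_cutNumbers_div_le j f v
  have h2 : (n : ℝ) ≤ n.size * q * ∑ v, ((I.cutNumbers j f v).card : ℝ) := by
    exact_mod_cast hf.le
  push_cast
  -- One factor `n.size * q` of the sample number lifts the cut size above `n`, the 8 cancels the
  -- one from the degree bound, and `(c + 2) * n.size` is left.
  calc ((c : ℝ) + 2) * n.size * (n / 2 ^ j)
      ≤ (c + 2) * n.size * ((n.size * q * ∑ v, ((I.cutNumbers j f v).card : ℝ)) / 2 ^ j) := by
        gcongr
    _ = (8 * (c + 2) * q * n.size ^ 2) *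
          ((∑ v, ((I.cutNumbers j f v).card : ℝ)) / (8 * 2 ^ j)) := by
        field_simp
    _ ≤ _ := by gcongr

/-- With high probability few edges join different components of the sampled forest. -/
theorem le_tapeMeasure_crossing_le (c q : ℕ) (hn : 0 < n) :
    ENNReal.ofReal (1 - 1 / (n : ℝ) ^ c) ≤
      tapeMeasure {ω | (I.crossing ω (8 * (c + 2) * q * n.size ^ 2)).ncard * q ≤ n} := by
  classical
  set k := 8 * (c + 2) * q * n.size ^ 2 with hk
  set l := n.size with hl
  have hl0 : 0 < l := Nat.size_pos.2 hn
  -- Only cuts with more than `n / (l * q)` edges matter: if there is none, the `l` size classes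
  -- contain at most `n / q` crossing edges in total.
  let bad (j : ℕ) (f : I.bigCenters j → Fin n) : Set (ℕ → Bool) :=
    if n < l * q * ∑ v, (I.cutNumbers j f v).card then I.avoiding k (I.cutNumbers j f) else ∅
  let U : Set (ℕ → Bool) := ⋃ j ∈ Finset.range l, ⋃ f ∈ Finset.univ, bad j f
  have hmeas : MeasurableSet U := by
    refine Finset.measurableSet_biUnion _ fun j _ => Finset.measurableSet_biUnion _ fun f _ => ?_
    simp only [bad]
    split_ifs
    exacts [I.measurableSet_avoiding _ _, .empty]
  have hsub : Uᶜ ⊆ {ω | (I.crossing ω k).ncard * q ≤ n} := by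
    intro ω hω
    by_contra hlt
    refine hω ?_
    simp only [Set.mem_ofPred_eq, not_le] at hlt
    obtain ⟨f, hf, hcard⟩ := I.exists_labelling ω k
    obtain ⟨j, hj, hjlt⟩ : ∃ j ∈ Finset.range l, n < l * q * ∑ v, (I.cutNumbers j (f j) v).card := by
      by_contra! hall
      have h1 : ∑ j ∈ Finset.range l, l * q * ∑ v, (I.cutNumbers j (f j) v).card ≤ l * n := by
        refine (Finset.sum_le_card_nsmul _ _ n hall).trans ?_
        simp
      rw [← Finset.mul_sum] at h1
      have h2 : l * ((I.crossing ω k).ncard * q) ≤ l * n :=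
        calc l * ((I.crossing ω k).ncard * q) = l * q * (I.crossing ω k).ncard := by ring
          _ ≤ _ := (Nat.mul_le_mul_left _ hcard).trans h1
      exact absurd (Nat.le_of_mul_le_mul_left h2 hl0) (by omega)
    refine Set.mem_biUnion hj (Set.mem_biUnion (Finset.mem_univ (f j)) ?_)
    simp only [bad, if_pos hjlt]
    exact hf j
  have hbad : ∀ j (f : I.bigCenters j → Fin n), tapeMeasure.real (bad j f) ≤
      Real.exp (-((c + 2) * l * (n / 2 ^ j : ℝ))) := by
    intro j f
    simp only [bad]
    split_ifs with h
    · exact I.tapeMeasure_avoiding_cutNumbers_le f h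
    · simp [Real.exp_nonneg]
  -- There are at most `n / 2 ^ j` large components, each with `n ≤ exp l` possible labels.
  have hlab : ∀ j, ((Finset.univ : Finset (I.bigCenters j → Fin n)).card : ℝ) ≤
      Real.exp (l * (n / 2 ^ j : ℝ)) := by
    intro j
    have h1 : ((I.bigCenters j).card : ℝ) ≤ n / 2 ^ j := by
      rw [le_div_iff₀ (by positivity), mul_comm]
      exact_mod_cast I.two_pow_mul_card_bigCenters_le j
    simp only [Finset.card_univ, Fintype.card_fun, Fintype.card_fin, Fintype.card_coe,
      Nat.cast_pow]
    calc (n : ℝ) ^ (I.bigCenters j).card ≤ Real.exp l ^ (I.bigCenters j).card := by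
          gcongr
          exact natCast_le_exp_size n
      _ = Real.exp (l * (I.bigCenters j).card) := by rw [← Real.exp_nat_mul, mul_comm]
      _ ≤ _ := by gcongr
  have hj : ∀ j ∈ Finset.range l, tapeMeasure.real (⋃ f ∈ Finset.univ, bad j f) ≤
      Real.exp (-((c + 1) * l)) := by
    intro j hj
    have h1 : (1 : ℝ) ≤ n / 2 ^ j := by
      rw [le_div_iff₀ (by positivity), one_mul]
      exact_mod_cast Nat.lt_size.1 (Finset.mem_range.1 hj)
    calc tapeMeasure.real (⋃ f ∈ Finset.univ, bad j f)
        ≤ ∑ f, tapeMeasure.real (bad j f) := measureReal_biUnion_finset_le _ _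
      _ ≤ ∑ f : I.bigCenters j → Fin n, Real.exp (-((c + 2) * l * (n / 2 ^ j : ℝ))) :=
          Finset.sum_le_sum fun f _ => hbad j f
      _ ≤ Real.exp (l * (n / 2 ^ j : ℝ)) * Real.exp (-((c + 2) * l * (n / 2 ^ j : ℝ))) := by
          rw [Finset.sum_const, nsmul_eq_mul]
          gcongr
          exact hlab j
      _ = Real.exp (-((c + 1) * l * (n / 2 ^ j : ℝ))) := by
          rw [← Real.exp_add]
          ring_nf
      _ ≤ _ := by
          refine Real.exp_le_exp.2 (neg_le_neg ?_)
          exact le_mul_of_one_le_right (by positivity) h1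
  have hU : tapeMeasure.real U ≤ 1 / (n : ℝ) ^ c := by
    calc tapeMeasure.real U
        ≤ ∑ j ∈ Finset.range l, tapeMeasure.real (⋃ f ∈ Finset.univ, bad j f) :=
          measureReal_biUnion_finset_le _ _
      _ ≤ ∑ j ∈ Finset.range l, Real.exp (-((c + 1) * l)) := Finset.sum_le_sum hj
      _ = l * Real.exp (-((c + 1) * l)) := by simp
      -- One of the `c + 1` factors pays for the sum over the size classes.
      _ ≤ Real.exp l * Real.exp (-((c + 1) * l)) := by
          gcongr
          linarith [Real.add_one_le_exp (l : ℝ)]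
      _ = (Real.exp l ^ c)⁻¹ := by
          rw [← Real.exp_add, ← Real.exp_nat_mul, ← Real.exp_neg]
          ring_nf
      _ ≤ 1 / (n : ℝ) ^ c := by
          rw [one_div]
          have : (0 : ℝ) < n := by exact_mod_cast hn
          gcongr
          exact natCast_le_exp_size n
  calc ENNReal.ofReal (1 - 1 / (n : ℝ) ^ c) ≤ ENNReal.ofReal (tapeMeasure.real Uᶜ) := by
        refine ENNReal.ofReal_le_ofReal ?_
        rw [probReal_compl_eq_one_sub hmeas]
        linarith
    _ = tapeMeasure Uᶜ := ofReal_measureReal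
    _ ≤ _ := measure_mono hsub

/-- The edges of the forest together with the edges between its components. -/
noncomputable def sparseSubgraph (ω : ℕ → Bool) (k : ℕ) : SimpleGraph (Fin n) where
  Adj u v := (I.sampleForest ω k (n * k)).Adj u v ∨
    I.graph.Adj u v ∧ ¬(I.sampleForest ω k (n * k)).Reachable u v
  symm := ⟨fun _ _ h => h.imp (fun h => h.symm) fun h => ⟨h.1.symm, fun h' => h.2 h'.symm⟩⟩
  loopless := ⟨fun _ h => h.elim (fun h => h.ne rfl) fun h => h.1.ne rfl⟩

/-- Along a walk of the graph, an omitted edge is replaced by a path of the forest. The `+ 1` in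
`hqε` is compensated by the forest having at most `n - 1` edges. -/
theorem isSSS_sparseSubgraph {ω : ℕ → Bool} {k q : ℕ} {ε : ℝ} (hn : 0 < n) (hq : 0 < q)
    (hqε : (n : ℝ) / q ≤ ε * n + 1)
    (h : (I.crossing ω k).ncard * q ≤ n) : IsSSS I.graph ε (I.sparseSubgraph ω k) := by
  have hle : I.sampleForest ω k (n * k) ≤ I.graph := I.sampleForest_le_graph ω k _
  have hsub : I.sparseSubgraph ω k ≤ I.graph := by
    intro u v huv
    exact huv.elim (fun h => hle h) fun h => h.1
  have hF : I.sampleForest ω k (n * k) ≤ I.sparseSubgraph ω k := fun u v huv => Or.inl huv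
  refine ⟨hsub, fun u v => ⟨fun h => h.mono hsub, ?_⟩, ?_⟩
  · rintro ⟨p⟩
    induction p with
    | nil => exact .refl _
    | @cons a b c hab _ ih =>
      refine SimpleGraph.Reachable.trans ?_ ih
      by_cases hr : (I.sampleForest ω k (n * k)).Reachable a b
      · exact hr.mono hF
      · exact SimpleGraph.Adj.reachable (Or.inr ⟨hab, hr⟩)
  · have h1 : (I.sparseSubgraph ω k).edgeSet ⊆
        (I.sampleForest ω k (n * k)).edgeSet ∪ I.crossing ω k := by
      intro e
      induction e with
      | h u v =>
        rintro (h | h)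
        · exact .inl h
        · refine .inr ⟨h.1, fun a b hab => ?_⟩
          rcases Sym2.eq_iff.1 hab with ⟨rfl, rfl⟩ | ⟨rfl, rfl⟩
          exacts [h.2, fun h' => h.2 h'.symm]
    have h2 := (Set.ncard_le_ncard h1).trans (Set.ncard_union_le _ _)
    have h3 := ncard_edgeSet_lt_of_isAcyclic hn (I.sampleForest_isAcyclic ω k (n * k))
    have h4 : ((I.crossing ω k).ncard : ℝ) ≤ n / q := by
      rw [le_div_iff₀ (by exact_mod_cast hq)]
      exact_mod_cast h
    have h5 : ((I.sparseSubgraph ω k).edgeSet.ncard : ℝ) + 1 ≤ n + (I.crossing ω k).ncard := by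
      exact_mod_cast (by omega)
    linarith

end GraphInput

end SSSLocal

namespace SSSLocal

/-! ### Running programs on states with bounded entries -/

/-- `SaysYes` asks only for some accepting run; determinism lets one known run settle negative
answers too. -/
theorem Exec.deterministic {n : ℕ} {I : GraphInput n} {ω : ℕ → Bool} {p : Prog} {s s₁ s₂ : State}
    {t₁ t₂ : ℕ} (h₁ : Exec I ω p s t₁ s₁) (h₂ : Exec I ω p s t₂ s₂) : s₁ = s₂ := by
  induction h₁ generalizing t₂ s₂ with
  | skip => cases h₂; rfl
  | instr => cases h₂; rfl
  | seq _ _ ih1 ih2 =>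
    cases h₂ with
    | seq a b => exact ih2 (ih1 a ▸ b)
  | iteTrue h _ ih =>
    cases h₂ with
    | iteTrue _ a => exact ih a
    | iteFalse h' _ => exact absurd h' h
  | iteFalse h _ ih =>
    cases h₂ with
    | iteTrue h' _ => exact absurd h h'
    | iteFalse _ a => exact ih a
  | loopStop h =>
    cases h₂ with
    | loopStop _ => rfl
    | loopStep h' _ _ => exact absurd h h'
  | loopStep h _ _ ih1 ih2 =>
    cases h₂ with
    | loopStop h' => exact absurd h' h
    | loopStep _ a b => exact ih2 (ih1 a ▸ b)

@[simp]
theorem State.set_reg (s : State) (d x r : ℕ) :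
    (s.set d x).reg r = if r = d then x else s.reg r := by
  simp [State.set, Function.update_apply]

@[simp]
theorem State.set_mem (s : State) (d x : ℕ) : (s.set d x).mem = s.mem := rfl

@[simp]
theorem State.set_pos (s : State) (d x : ℕ) : (s.set d x).pos = s.pos := rfl

/-- All registers and memory cells hold numbers at most `N`. -/
structure State.Bdd (N : ℕ) (s : State) : Prop where
  reg : ∀ r, s.reg r ≤ N
  mem : ∀ a, s.mem a ≤ N

theorem State.Bdd.set {N : ℕ} {s : State} (h : s.Bdd N) (d : ℕ) {x : ℕ} (hx : x ≤ N) :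
    (s.set d x).Bdd N := by
  refine ⟨fun r => ?_, h.mem⟩
  rw [State.set_reg]
  split_ifs
  exacts [hx, h.reg r]

/-- The instruction does not produce a number above `N` from numbers at most `N`. -/
def Instr.Safe (N : ℕ) : Instr → State → Prop
  | .const _ k, _ => k ≤ N
  | .op .add _ a b, s => s.reg a + s.reg b ≤ N
  | .op .mul _ a b, s => s.reg a * s.reg b ≤ N
  | _, _ => True

namespace GraphInput

variable {n : ℕ} (I : GraphInput n)

theorem degAt_le (v : ℕ) : I.degAt v ≤ n := by
  rcases lt_or_ge v n with h | h
  · exact (I.degAt_val ⟨v, h⟩).trans_le (I.degree_lt _).le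
  · simp [degAt, h.not_gt]

theorem nbrAt_le (v i : ℕ) : I.nbrAt v i ≤ n := by
  unfold nbrAt
  split_ifs
  · rcases (I.nbrs _)[i]? with _ | w
    · simp
    · simp [w.2.le]
  · exact Nat.zero_le _

theorem adjAt_le (u v : ℕ) : I.adjAt u v ≤ 1 := by
  unfold adjAt
  split_ifs <;> simp

end GraphInput

section Halts

variable {n : ℕ} {I : GraphInput n} {ω : ℕ → Bool} {N : ℕ}

theorem Instr.exec_bdd (hN : n < N) {i : Instr} {s : State} (hs : s.Bdd N) (h : i.Safe N s) :
    (i.exec I ω s).Bdd N := by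
  have h1 : 1 ≤ N := by omega
  cases i with
  | const d k => exact hs.set d h
  | op o d a b =>
    have ha := hs.reg a
    have hb := hs.reg b
    refine hs.set d ?_
    cases o with
    | add => exact h
    | sub => exact (Nat.sub_le _ _).trans ha
    | mul => exact h
    | div => exact (Nat.div_le_self _ _).trans ha
    | mod => exact (Nat.mod_le _ _).trans ha
    | lt => simp only [BinOp.eval]; split_ifs <;> omega
    | eq => simp only [BinOp.eval]; split_ifs <;> omega
  | load d a => exact hs.set d (hs.mem _)
  | store a b =>
    refine ⟨hs.reg, fun c => ?_⟩
    simp only [Instr.exec, Function.update_apply]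
    split_ifs
    exacts [hs.reg b, hs.mem c]
  | bit d =>
    have := hs.set d (x := (ω s.pos).toNat) ((Bool.toNat_le _).trans h1)
    exact ⟨this.reg, this.mem⟩
  | deg d v => exact hs.set d ((I.degAt_le _).trans hN.le)
  | nbr d v i => exact hs.set d ((I.nbrAt_le _ _).trans hN.le)
  | adj d u v => exact hs.set d ((I.adjAt_le _ _).trans h1)

theorem Instr.cost_le (hN : n < N) {i : Instr} {s : State} (hs : s.Bdd N) (h : i.Safe N s) :
    i.cost I s ≤ 1 + 3 * N.size := by
  have hr : ∀ r, (s.reg r).size ≤ N.size := fun r => Nat.size_le_size (hs.reg r)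
  have hm : ∀ r, (s.mem r).size ≤ N.size := fun r => Nat.size_le_size (hs.mem r)
  cases i with
  | const d k =>
    have : k.size ≤ N.size := Nat.size_le_size h
    simp only [Instr.cost]; omega
  | op o d a b => have := hr a; have := hr b; simp only [Instr.cost]; omega
  | load d a => have := hr a; have := hm (s.reg a); simp only [Instr.cost]; omega
  | store a b => have := hr a; have := hr b; simp only [Instr.cost]; omega
  | bit d => simp only [Instr.cost]; omega
  | deg d v =>
    have := hr v
    have : (I.degAt (s.reg v)).size ≤ N.size := Nat.size_le_size ((I.degAt_le _).trans hN.le)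
    simp only [Instr.cost]; omega
  | nbr d v i =>
    have := hr v
    have := hr i
    have : (I.nbrAt (s.reg v) (s.reg i)).size ≤ N.size :=
      Nat.size_le_size ((I.nbrAt_le _ _).trans hN.le)
    simp only [Instr.cost]; omega
  | adj d u v => have := hr u; have := hr v; simp only [Instr.cost]; omega

variable (I ω N) in
/-- Started in the state `s`, if its entries are at most `N`, the program `p` makes at most `m`
steps (each of cost at most `1 + 3 * N.size`) and halts in a state with the property `Q`, again with
all entries at most `N`. -/
def Halts (p : Prog) (s : State) (m : ℕ) (Q : State → Prop) : Prop :=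
  s.Bdd N → ∃ t s', Exec I ω p s t s' ∧ t ≤ m * (1 + 3 * N.size) ∧ s'.Bdd N ∧ Q s'

theorem Halts.mono {p : Prog} {s : State} {m m' : ℕ} {Q Q' : State → Prop}
    (h : Halts I ω N p s m Q) (hm : m ≤ m') (hQ : ∀ s', Q s' → Q' s') : Halts I ω N p s m' Q' :=
  fun hs =>
    let ⟨t, s', he, ht, hb, hq⟩ := h hs
    ⟨t, s', he, ht.trans (Nat.mul_le_mul_right _ hm), hb, hQ s' hq⟩

theorem Halts.skip {s : State} {m : ℕ} {Q : State → Prop} (h : Q s) : Halts I ω N .skip s m Q :=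
  fun hs => ⟨0, s, .skip s, Nat.zero_le _, hs, h⟩

/-- The postcondition of the first program is itself a `Halts` statement, so proofs run forward
through the program. -/
theorem Halts.seq {p q : Prog} {s : State} {m₁ m₂ : ℕ} {Q : State → Prop}
    (h : Halts I ω N p s m₁ fun s' => Halts I ω N q s' m₂ Q) :
    Halts I ω N (.seq p q) s (m₁ + m₂) Q := by
  intro hs
  obtain ⟨t, s', he, ht, hb, hq⟩ := h hs
  obtain ⟨t', s'', he', ht', hb', hq'⟩ := hq hb
  refine ⟨t + t', s'', .seq he he', ?_, hb', hq'⟩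
  rw [add_mul]
  omega

theorem Halts.seq' {p q : Prog} {s : State} {m₁ m₂ : ℕ} {R Q : State → Prop}
    (h : Halts I ω N p s m₁ R) (h' : ∀ s', R s' → Halts I ω N q s' m₂ Q) :
    Halts I ω N (.seq p q) s (m₁ + m₂) Q := .seq (h.mono le_rfl h')

theorem Halts.ite {r : ℕ} {p q : Prog} {s : State} {m : ℕ} {Q : State → Prop}
    (h₁ : s.reg r ≠ 0 → Halts I ω N p s m Q) (h₂ : s.reg r = 0 → Halts I ω N q s m Q) :
    Halts I ω N (.ite r p q) s (1 + m) Q := by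
  intro hs
  have hr : (s.reg r).size ≤ N.size := Nat.size_le_size (hs.reg r)
  by_cases h : s.reg r = 0
  · obtain ⟨t, s', he, ht, hb, hq⟩ := h₂ h hs
    refine ⟨_, s', .iteFalse h he, ?_, hb, hq⟩
    rw [add_mul]
    omega
  · obtain ⟨t, s', he, ht, hb, hq⟩ := h₁ h hs
    refine ⟨_, s', .iteTrue h he, ?_, hb, hq⟩
    rw [add_mul]
    omega

theorem Halts.loopStop {r : ℕ} {p : Prog} {s : State} {m : ℕ} {Q : State → Prop}
    (hm : 1 ≤ m) (h : s.reg r = 0) (hQ : Q s) : Halts I ω N (.loop r p) s m Q := by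
  refine fun hs => ⟨1, s, .loopStop h, ?_, hs, hQ⟩
  nlinarith

theorem Halts.loopStep {r : ℕ} {p : Prog} {s : State} {m₁ m₂ : ℕ} {Q : State → Prop}
    (h : s.reg r ≠ 0) (hp : Halts I ω N p s m₁ fun s' => Halts I ω N (.loop r p) s' m₂ Q) :
    Halts I ω N (.loop r p) s (1 + m₁ + m₂) Q := by
  intro hs
  have hr : (s.reg r).size ≤ N.size := Nat.size_le_size (hs.reg r)
  obtain ⟨t, s', he, ht, hb, hq⟩ := hp hs
  obtain ⟨t', s'', he', ht', hb', hq'⟩ := hq hb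
  refine ⟨_, s'', .loopStep h he he', ?_, hb', hq'⟩
  rw [add_mul, add_mul]
  omega

/-- A sequence of elementary instructions. -/
def block : List Instr → Prog
  | [] => .skip
  | i :: l => .seq (.instr i) (block l)

variable (I ω) in
/-- The effect of a sequence of instructions. -/
noncomputable def blockExec : List Instr → State → State
  | [], s => s
  | i :: l, s => blockExec l (i.exec I ω s)

variable (I ω N) in
/-- No instruction of the sequence produces a number above `N`. -/
def BlockSafe : List Instr → State → Prop
  | [], _ => True
  | i :: l, s => i.Safe N s ∧ BlockSafe l (i.exec I ω s)

theorem Halts.block (hN : n < N) {l : List Instr} {s : State} {Q : State → Prop}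
    (h : BlockSafe I ω N l s) (hQ : Q (blockExec I ω l s)) :
    Halts I ω N (block l) s l.length Q := by
  induction l generalizing s with
  | nil => exact .skip hQ
  | cons i l ih =>
    rw [List.length_cons, add_comm]
    refine .seq fun hs => ?_
    refine ⟨_, _, .instr i s, ?_, Instr.exec_bdd hN hs h.1, ih h.2 hQ⟩
    rw [one_mul]
    exact Instr.cost_le hN hs h.1

end Halts

/-! ### Union-find with union by size -/

/-- In the memory, cell `x` holds `0` if `x` is a root and otherwise one plus the parent of `x`, and
cell `n + x` holds the size of the tree of `x` minus one; the trees are the components of `F`. -/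
structure Rep {n : ℕ} (F : SimpleGraph (Fin n)) (mem : ℕ → ℕ) : Prop where
  parent : ∀ x : Fin n, mem x ≠ 0 → ∃ y : Fin n, mem x = y + 1 ∧ F.Reachable x y ∧
    2 * (mem (n + x) + 1) ≤ mem (n + y) + 1
  root_unique : ∀ x y : Fin n, mem x = 0 → mem y = 0 → F.Reachable x y → x = y
  root_size : ∀ x : Fin n, mem x = 0 → mem (n + x) + 1 = compSize F x
  size_le : ∀ x : Fin n, mem (n + x) + 1 ≤ n

/-- Storing sizes minus one and parents plus one makes the initial zero memory valid. -/
theorem Rep.init {n : ℕ} : Rep (⊥ : SimpleGraph (Fin n)) fun _ => 0 where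
  parent := by simp
  root_unique x y _ _ h := by simpa using h
  root_size x _ := by simp [compSize]
  size_le x := by have := x.2; omega

theorem Rep.congr {n : ℕ} {F : SimpleGraph (Fin n)} {mem mem' : ℕ → ℕ} (h : Rep F mem)
    (hm : ∀ a < 2 * n, mem' a = mem a) : Rep F mem' := by
  have h1 : ∀ x : Fin n, mem' x = mem x := fun x => hm _ (by omega)
  have h2 : ∀ x : Fin n, mem' (n + x) = mem (n + x) := fun x => hm _ (by omega)
  constructor
  · simpa only [h1, h2] using h.parent
  · simpa only [h1, h2] using h.root_unique
  · simpa only [h1, h2] using h.root_size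
  · simpa only [h1, h2] using h.size_le

/-- The smaller tree goes below the larger one, so the stored size at least doubles along the new
pointer. A node that is no longer a root keeps its old entry, while the entries of roots only grow,
so doubling persists along all pointers. -/
theorem Rep.attach {n : ℕ} {F F' : SimpleGraph (Fin n)} {mem : ℕ → ℕ} (h : Rep F mem)
    {a b : Fin n} (ha : mem a = 0) (hb : mem b = 0) (hab : ¬F.Reachable a b)
    (hle : mem (n + b) ≤ mem (n + a))
    (hF' : ∀ p q, F'.Reachable p q ↔ F.Reachable p q ∨
      (F.Reachable p a ∧ F.Reachable b q) ∨ (F.Reachable p b ∧ F.Reachable a q)) :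
    Rep F' (Function.update (Function.update mem b (a + 1)) (n + a)
      (mem (n + a) + mem (n + b) + 1)) := by
  have hne : a ≠ b := fun e => hab (e ▸ .refl a)
  set mem' := Function.update (Function.update mem b (a + 1)) (n + a)
    (mem (n + a) + mem (n + b) + 1) with hmem'
  have e1 : ∀ x : Fin n, mem' x = if x = b then (a : ℕ) + 1 else mem x := by
    intro x
    have : (x : ℕ) ≠ n + a := by omega
    simp [hmem', Function.update_apply, this, Fin.ext_iff]
  have e2 : ∀ x : Fin n, mem' (n + x) =
      if x = a then mem (n + a) + mem (n + b) + 1 else mem (n + x) := by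
    intro x
    have : n + (x : ℕ) ≠ b := by omega
    simp [hmem', Function.update_apply, this, Fin.ext_iff]
  have hsize : compSize F' a = compSize F a + compSize F b := by
    unfold compSize
    rw [← Set.ncard_union_eq]
    · congr 1
      ext w
      simp only [Set.mem_ofPred_eq, Set.mem_union, hF']
      constructor
      · rintro (h | h | h)
        exacts [.inl h, .inr h.2, .inl h.2]
      · rintro (h | h)
        exacts [.inl h, .inr (.inl ⟨.refl _, h⟩)]
    · exact Set.disjoint_left.2 fun w h1 h2 => hab (h1.trans h2.symm)
  have hra := h.root_size a ha
  have hrb := h.root_size b hb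
  constructor
  · intro x hx
    rw [e1] at hx
    rw [e1]
    by_cases hxb : x = b
    · subst hxb
      refine ⟨a, if_pos rfl, (hF' _ _).2 (.inr (.inr ⟨.refl _, .refl _⟩)), ?_⟩
      rw [e2, e2, if_neg (Ne.symm hne), if_pos rfl]
      omega
    · rw [if_neg hxb] at hx ⊢
      obtain ⟨y, hy, hxy, hs⟩ := h.parent x hx
      refine ⟨y, hy, (hF' _ _).2 (.inl hxy), ?_⟩
      have hxa : x ≠ a := fun e => hx (e ▸ ha)
      rw [e2, e2, if_neg hxa]
      split_ifs with hya
      · subst hya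
        omega
      · exact hs
  · intro x y hx hy hxy
    rw [e1] at hx hy
    split_ifs at hx hy with hxb hyb
    rcases (hF' x y).1 hxy with h1 | ⟨-, h1⟩ | ⟨h1, -⟩
    · exact h.root_unique x y hx hy h1
    · exact absurd (h.root_unique b y hb hy h1).symm hyb
    · exact absurd (h.root_unique x b hx hb h1) hxb
  · intro x hx
    rw [e1] at hx
    rw [e2]
    split_ifs at hx with hxb
    split_ifs with hxa
    · subst hxa
      omega
    · rw [h.root_size x hx]
      unfold compSize
      congr 1
      ext w
      simp only [Set.mem_ofPred_eq, hF']
      refine ⟨.inl, ?_⟩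
      rintro (h1 | ⟨h1, -⟩ | ⟨h1, -⟩)
      · exact h1
      · exact absurd (h.root_unique x a hx ha h1) hxa
      · exact absurd (h.root_unique x b hx hb h1) hxb
  · intro x
    rw [e2]
    split_ifs with hxa
    · have := compSize_le_card F' a
      omega
    · exact h.size_le x

end SSSLocal

namespace SSSLocal

open Instr BinOp

/-! ### The program -/

/-- Replace the node in register `a` by the root of its tree. -/
def findProg (a : ℕ) : Prog :=
  .seq (block [load 11 a]) (.loop 11 (block [op sub a 11 4, load 11 a]))

/-- Set the flag if the edge in registers `7, 8` is the queried one. -/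
def flagProg : Prog :=
  .seq (block [op eq 11 7 2, op eq 12 8 3, op mul 11 11 12, op eq 12 7 3, op eq 13 8 2,
    op mul 12 12 13, op add 11 11 12]) (.ite 11 (block [const 6 1]) .skip)

/-- Join the trees with the roots in registers `9, 10`. -/
def linkProg : Prog :=
  .seq (block [op add 12 0 9, load 13 12, op add 14 0 10, load 15 14, op lt 11 13 15,
    op add 13 13 15, op add 13 13 4])
    (.ite 11 (block [op add 15 10 4, store 9 15, store 14 13])
      (block [op add 15 9 4, store 10 15, store 12 13]))

/-- Process the edge in registers `7, 8`. -/
def unionProg : Prog :=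
  .seq (block [op add 9 7 5, op add 10 8 5]) (.seq (findProg 9) (.seq (findProg 10)
    (.seq (block [op eq 11 9 10]) (.ite 11 .skip (.seq linkProg flagProg)))))

/-! ### Correctness and cost of union-find -/

section Union

variable {n : ℕ} {I : GraphInput n} {ω : ℕ → Bool} {N : ℕ}

/-- Each move to a parent at least doubles the stored size, which never exceeds `n`. The hypothesis
`hd` thus limits the remaining moves, and for `d = 0` it is contradictory. -/
theorem halts_findLoop (hN : n < N) {F : SimpleGraph (Fin n)} {a : ℕ} (ha : a ≠ 4) (ha' : a ≠ 11)
    (d : ℕ) {s : State} (hrep : Rep F s.mem) (h4 : s.reg 4 = 1) {x : Fin n} (hx : s.reg a = x)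
    (h11 : s.reg 11 = s.mem x) (hd : n < (s.mem (n + x) + 1) * 2 ^ d) :
    Halts I ω N (.loop 11 (block [op sub a 11 4, load 11 a])) s (3 * d + 1) fun s' =>
      ∃ z : Fin n, s.mem z = 0 ∧ F.Reachable x z ∧ s'.reg a = z ∧ s'.mem = s.mem ∧
        s'.pos = s.pos ∧ ∀ r, r ≠ a → r ≠ 11 → s'.reg r = s.reg r := by
  induction d generalizing s x with
  | zero =>
    have := hrep.size_le x
    omega
  | succ d ih =>
    by_cases h0 : s.mem x = 0
    · exact .loopStop (by omega) (h11.trans h0) ⟨x, h0, .refl _, hx, rfl, rfl, fun _ _ _ => rfl⟩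
    · obtain ⟨y, hy, hxy, hs⟩ := hrep.parent x h0
      refine Halts.mono (m := 1 + 2 + (3 * d + 1)) (.loopStep (h11 ▸ h0) ?_) (by omega)
        fun _ h => h
      refine Halts.block hN (by simp [BlockSafe, Safe]) ?_
      set s₁ := blockExec I ω [op sub a 11 4, load 11 a] s with hs₁
      have e1 : s₁.mem = s.mem := by simp [hs₁, blockExec, exec]
      have e2 : s₁.reg a = y := by
        simp [hs₁, blockExec, exec, BinOp.eval, ha', h11, h4, hy]
      have e3 : s₁.reg 11 = s₁.mem y := by
        simp [hs₁, blockExec, exec, BinOp.eval, h11, h4, hy]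
      have e4 : ∀ r, r ≠ a → r ≠ 11 → s₁.reg r = s.reg r := by
        intro r h1 h2
        simp [hs₁, blockExec, exec, h1, h2]
      have e5 : s₁.pos = s.pos := by simp [hs₁, blockExec, exec]
      refine (ih (s := s₁) (e1 ▸ hrep) ((e4 4 ha.symm (by omega)).trans h4) e2 e3 ?_).mono le_rfl ?_
      · rw [e1]
        rw [pow_succ] at hd
        nlinarith [Nat.one_le_two_pow (n := d)]
      · rintro s' ⟨z, hz, hyz, h1, h2, h3, h4⟩
        rw [e1] at hz h2
        exact ⟨z, hz, hxy.trans hyz, h1, h2, h3.trans e5, fun r h h' =>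
          (h4 r h h').trans (e4 r h h')⟩

theorem halts_findProg (hN : n < N) {F : SimpleGraph (Fin n)} {a : ℕ} (ha : a ≠ 4) (ha' : a ≠ 11)
    {s : State} (hrep : Rep F s.mem) (h4 : s.reg 4 = 1) {x : Fin n} (hx : s.reg a = x) :
    Halts I ω N (findProg a) s (3 * n.size + 2) fun s' =>
      ∃ z : Fin n, s.mem z = 0 ∧ F.Reachable x z ∧ s'.reg a = z ∧ s'.mem = s.mem ∧
        s'.pos = s.pos ∧ ∀ r, r ≠ a → r ≠ 11 → s'.reg r = s.reg r := by
  refine Halts.mono (m := 1 + (3 * n.size + 1)) (.seq (Halts.block hN (by simp [BlockSafe, Safe]) ?_))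
    (by omega) fun _ h => h
  set s₁ := blockExec I ω [load 11 a] s with hs₁
  have e1 : s₁.mem = s.mem := by simp [hs₁, blockExec, exec]
  have e2 : s₁.reg a = x := by simp [hs₁, blockExec, exec, ha', hx]
  have e3 : s₁.reg 11 = s₁.mem x := by simp [hs₁, blockExec, exec, hx]
  have e4 : ∀ r, r ≠ 11 → s₁.reg r = s.reg r := by
    intro r h
    simp [hs₁, blockExec, exec, h]
  refine (halts_findLoop hN ha ha' n.size (s := s₁) (e1 ▸ hrep) ((e4 4 (by omega)).trans h4) e2 e3
    ?_).mono le_rfl ?_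
  · have := Nat.lt_size_self n
    nlinarith
  · rintro s' ⟨z, hz, hyz, h1, h2, h3, h4⟩
    rw [e1] at hz h2
    exact ⟨z, hz, hyz, h1, h2, h3, fun r h h' => (h4 r h h').trans (e4 r h')⟩

open Classical in
/-- The registers that stay fixed or hold the answer so far, and the memory representing `F`. -/
structure Core (F : SimpleGraph (Fin n)) (u v : Fin n) (s : State) : Prop where
  nodes : s.reg 0 = n
  left : s.reg 2 = u
  right : s.reg 3 = v
  one : s.reg 4 = 1
  zero : s.reg 5 = 0
  flag : s.reg 6 = if F.Adj u v then 1 else 0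
  offset : s.reg 16 = 2 * n
  two : s.reg 22 = 2
  rep : Rep F s.mem

/-- The part of the state that is not changed when an edge is processed. -/
structure SameFrame (n : ℕ) (s s' : State) : Prop where
  reg : ∀ r, 16 ≤ r ∨ r = 1 ∨ r = 7 ∨ r = 8 → s'.reg r = s.reg r
  mem : ∀ a, 2 * n ≤ a → s'.mem a = s.mem a
  pos : s'.pos = s.pos

theorem SameFrame.trans {s s' s'' : State} (h : SameFrame n s s') (h' : SameFrame n s' s'') :
    SameFrame n s s'' where
  reg r hr := (h'.reg r hr).trans (h.reg r hr)
  mem a ha := (h'.mem a ha).trans (h.mem a ha)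
  pos := h'.pos.trans h.pos

theorem halts_linkProg (hN : 4 * n + 4 ≤ N) {F : SimpleGraph (Fin n)} {s : State} {x y a b : Fin n}
    (hrep : Rep F s.mem) (h0 : s.reg 0 = n) (h4 : s.reg 4 = 1) (h9 : s.reg 9 = a)
    (h10 : s.reg 10 = b) (ha : s.mem a = 0) (hb : s.mem b = 0) (hxa : F.Reachable x a)
    (hyb : F.Reachable y b) (hxy : ¬F.Reachable x y) :
    Halts I ω N linkProg s 11 fun s' =>
      Rep (addEdge F x y) s'.mem ∧ SameFrame n s s' ∧ ∀ r < 9, s'.reg r = s.reg r := by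
  have hN' : n < N := by omega
  have hsa := hrep.size_le a
  have hsb := hrep.size_le b
  have hF' : ∀ p q, (addEdge F x y).Reachable p q ↔ F.Reachable p q ∨
      (F.Reachable p a ∧ F.Reachable b q) ∨ (F.Reachable p b ∧ F.Reachable a q) := by
    intro p q
    rw [addEdge_of_not_reachable hxy, reachable_sup_edge_iff]
    have e1 : F.Reachable p x ↔ F.Reachable p a := ⟨fun h => h.trans hxa, fun h => h.trans hxa.symm⟩
    have e2 : F.Reachable p y ↔ F.Reachable p b := ⟨fun h => h.trans hyb, fun h => h.trans hyb.symm⟩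
    have e3 : F.Reachable x q ↔ F.Reachable a q := ⟨hxa.symm.trans, hxa.trans⟩
    have e4 : F.Reachable y q ↔ F.Reachable b q := ⟨hyb.symm.trans, hyb.trans⟩
    rw [e1, e2, e3, e4]
  have hab : ¬F.Reachable a b := fun h => hxy (hxa.trans (h.trans hyb.symm))
  refine Halts.mono (m := 7 + (1 + 3)) (.seq (Halts.block hN' ?_ ?_)) le_rfl fun _ h => h
  · simp [BlockSafe, Safe, exec, BinOp.eval, h0, h9, h10, h4]
    omega
  refine .ite (fun hc => Halts.block hN' ?_ ?_) fun hc => Halts.block hN' ?_ ?_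
  · simp [blockExec, BlockSafe, Safe, exec, BinOp.eval, h10, h4]
    omega
  · have hlt : s.mem (n + a) < s.mem (n + b) := by
      simpa [blockExec, exec, BinOp.eval, h0, h9, h10, h4] using hc
    refine ⟨?_, ⟨?_, ?_, ?_⟩, ?_⟩
    · have := hrep.attach hb ha (fun h => hab h.symm) hlt.le (fun p q => (hF' p q).trans
        (or_congr_right or_comm))
      simpa [blockExec, exec, BinOp.eval, h0, h9, h10, h4, add_comm (s.mem (n + a))] using this
    · intro r hr
      simp only [blockExec, exec, State.set_reg]
      repeat rw [if_neg (by omega)]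
    · intro c hc
      have e1 : c ≠ n + b := by omega
      have e2 : c ≠ a := by omega
      simp [blockExec, exec, BinOp.eval, h0, h9, h10, e1, e2]
    · simp [blockExec, exec]
    · intro r hr
      simp only [blockExec, exec, State.set_reg]
      repeat rw [if_neg (by omega)]
  · simp [blockExec, BlockSafe, Safe, exec, BinOp.eval, h9, h4]
    omega
  · have hle : s.mem (n + b) ≤ s.mem (n + a) := by
      simpa [blockExec, exec, BinOp.eval, h0, h9, h10, h4] using hc
    refine ⟨?_, ⟨?_, ?_, ?_⟩, ?_⟩
    · have := hrep.attach ha hb hab hle hF'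
      simpa [blockExec, exec, BinOp.eval, h0, h9, h10, h4] using this
    · intro r hr
      simp only [blockExec, exec, State.set_reg]
      repeat rw [if_neg (by omega)]
    · intro c hc
      have e1 : c ≠ n + a := by omega
      have e2 : c ≠ b := by omega
      simp [blockExec, exec, BinOp.eval, h0, h9, h10, e1, e2]
    · simp [blockExec, exec]
    · intro r hr
      simp only [blockExec, exec, State.set_reg]
      repeat rw [if_neg (by omega)]

open Classical in
-- This runs only after a link, so the flag records whether the queried edge has entered the forest.
-- Products and sums of comparison bits act as "and" and "or" over both orientations.
theorem halts_flagProg (hN : 4 * n + 4 ≤ N) {F : SimpleGraph (Fin n)} {s : State}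
    {u v x y : Fin n} (h2 : s.reg 2 = u) (h3 : s.reg 3 = v)
    (h6 : s.reg 6 = if F.Adj u v then 1 else 0) (h7 : s.reg 7 = x) (h8 : s.reg 8 = y)
    (hxy : ¬F.Reachable x y) :
    Halts I ω N flagProg s 9 fun s' =>
      s'.reg 6 = (if (addEdge F x y).Adj u v then 1 else 0) ∧ s'.mem = s.mem ∧
        SameFrame n s s' ∧ ∀ r < 9, r ≠ 6 → s'.reg r = s.reg r := by
  have hN' : n < N := by omega
  have hne : x ≠ y := fun e => hxy (e ▸ .refl _)
  have hadj : (addEdge F x y).Adj u v ↔ F.Adj u v ∨ (x = u ∧ y = v ∨ x = v ∧ y = u) := by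
    rw [addEdge_of_not_reachable hxy, SimpleGraph.sup_adj, SimpleGraph.edge_adj]
    constructor
    · rintro (h | ⟨⟨rfl, rfl⟩ | ⟨rfl, rfl⟩, -⟩) <;> simp [*]
    · rintro (h | ⟨rfl, rfl⟩ | ⟨rfl, rfl⟩)
      exacts [.inl h, .inr ⟨.inl ⟨rfl, rfl⟩, hne⟩, .inr ⟨.inr ⟨rfl, rfl⟩, hne.symm⟩]
  refine Halts.mono (m := 7 + (1 + 1)) (.seq (Halts.block hN' ?_ ?_)) le_rfl fun _ h => h
  · simp only [BlockSafe, Safe, exec, BinOp.eval, State.set_reg]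
    norm_num
    refine ⟨?_, ?_, ?_⟩ <;> split_ifs <;> omega
  have hcond : (blockExec I ω [op eq 11 7 2, op eq 12 8 3, op mul 11 11 12, op eq 12 7 3,
      op eq 13 8 2, op mul 12 12 13, op add 11 11 12] s).reg 11 = 0 ↔
      ¬(x = u ∧ y = v ∨ x = v ∧ y = u) := by
    simp only [blockExec, exec, BinOp.eval, State.set_reg]
    norm_num [h2, h3, h7, h8, Fin.val_inj]
    tauto
  refine .ite (fun hc => (Halts.block hN' ?_ ?_).mono le_rfl fun _ h => h)
    fun hc => .skip ?_
  · simp [BlockSafe, Safe]; omega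
  · rw [ne_eq, hcond, not_not] at hc
    refine ⟨?_, ?_, ⟨?_, ?_, ?_⟩, ?_⟩
    · simp [blockExec, exec, hadj, hc]
    · simp [blockExec, exec]
    · intro r hr
      simp only [blockExec, exec, State.set_reg]
      repeat rw [if_neg (by omega)]
    · simp [blockExec, exec]
    · simp [blockExec, exec]
    · intro r hr hr'
      simp only [blockExec, exec, State.set_reg]
      repeat rw [if_neg (by omega)]
  · rw [hcond] at hc
    refine ⟨?_, ?_, ⟨?_, ?_, ?_⟩, ?_⟩
    · simp [blockExec, exec, hadj, hc, h6]
    · simp [blockExec, exec]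
    · intro r hr
      simp only [blockExec, exec, State.set_reg]
      repeat rw [if_neg (by omega)]
    · simp [blockExec, exec]
    · simp [blockExec, exec]
    · intro r hr hr'
      simp only [blockExec, exec, State.set_reg]
      repeat rw [if_neg (by omega)]

/-- By `root_unique`, comparing roots decides reachability, so the program mirrors the case split in
`addEdge`. Two searches dominate the cost. -/
theorem halts_unionProg (hN : 4 * n + 4 ≤ N) {F : SimpleGraph (Fin n)} {s : State}
    {u v x y : Fin n} (h : Core F u v s) (h7 : s.reg 7 = x) (h8 : s.reg 8 = y) :
    Halts I ω N unionProg s (6 * n.size + 28) fun s' =>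
      Core (addEdge F x y) u v s' ∧ SameFrame n s s' := by
  have hN' : n < N := by omega
  refine Halts.mono (m := 2 + ((3 * n.size + 2) + ((3 * n.size + 2) + (1 + (1 + (11 + 9))))))
    (Halts.seq (Halts.block hN' ?_ ?_)) (by omega) fun _ h => h
  · simp [BlockSafe, Safe, exec, h7, h8, h.zero]
    omega
  set s₁ := blockExec I ω [op add 9 7 5, op add 10 8 5] s with hs₁
  have e9 : s₁.reg 9 = x := by simp [hs₁, blockExec, exec, BinOp.eval, h7, h.zero]
  have e10 : s₁.reg 10 = y := by simp [hs₁, blockExec, exec, BinOp.eval, h8, h.zero]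
  have em : s₁.mem = s.mem := by simp [hs₁, blockExec, exec]
  have ep : s₁.pos = s.pos := by simp [hs₁, blockExec, exec]
  have er : ∀ r, r ≠ 9 → r ≠ 10 → s₁.reg r = s.reg r := by
    intro r h1 h2
    simp [hs₁, blockExec, exec, h1, h2]
  refine .seq' (halts_findProg hN' (by omega) (by omega) (em ▸ h.rep)
    ((er 4 (by omega) (by omega)).trans h.one) e9) ?_
  rintro s₂ ⟨a, ha, hxa, f9, fm, fp, fr⟩
  rw [em] at fm ha
  refine .seq' (halts_findProg hN' (by omega) (by omega) (fm ▸ h.rep)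
    (((fr 4 (by omega) (by omega)).trans (er 4 (by omega) (by omega))).trans h.one)
    ((fr 10 (by omega) (by omega)).trans e10)) ?_
  rintro s₃ ⟨b, hb, hyb, g10, gm, gp, gr⟩
  rw [fm] at gm hb
  have g9 : s₃.reg 9 = a := (gr 9 (by omega) (by omega)).trans f9
  have gr' : ∀ r, r < 9 ∨ 11 < r → s₃.reg r = s.reg r := fun r hr =>
    (gr r (by omega) (by omega)).trans ((fr r (by omega) (by omega)).trans
      (er r (by omega) (by omega)))
  refine .seq (Halts.block hN' (by simp [BlockSafe, Safe]) ?_)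
  set s₄ := blockExec I ω [op eq 11 9 10] s₃ with hs₄
  have k11 : s₄.reg 11 = if a = b then 1 else 0 := by
    simp [hs₄, blockExec, exec, BinOp.eval, g9, g10, Fin.val_inj]
  have km : s₄.mem = s.mem := by simp [hs₄, blockExec, exec, gm]
  have kr : ∀ r, r < 9 ∨ 11 < r → s₄.reg r = s.reg r := by
    intro r hr
    have : r ≠ 11 := by omega
    simp [hs₄, blockExec, exec, this, gr' r hr]
  have k9 : s₄.reg 9 = a := by simp [hs₄, blockExec, exec, g9]
  have k10 : s₄.reg 10 = b := by simp [hs₄, blockExec, exec, g10]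
  have kp : s₄.pos = s.pos := by simp [hs₄, blockExec, exec, gp, fp, ep]
  have kframe : SameFrame n s s₄ := ⟨fun r hr => kr r (by omega), fun c _ => by rw [km], kp⟩
  refine .ite (fun hc => .skip ?_) fun hc => ?_
  · have hab : a = b := by
      by_contra hne
      exact hc (by rw [k11, if_neg hne])
    rw [addEdge_of_reachable (hxa.trans (hab ▸ hyb.symm))]
    refine ⟨⟨?_, ?_, ?_, ?_, ?_, ?_, ?_, ?_, km ▸ h.rep⟩, kframe⟩
    all_goals rw [kr _ (by omega)]
    exacts [h.nodes, h.left, h.right, h.one, h.zero, h.flag, h.offset, h.two]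
  · have hab : a ≠ b := by
      rintro rfl
      simp [k11] at hc
    have hxy : ¬F.Reachable x y := fun hr =>
      hab (h.rep.root_unique a b ha hb (hxa.symm.trans (hr.trans hyb)))
    refine .seq' (halts_linkProg hN (km ▸ h.rep) ((kr 0 (by omega)).trans h.nodes)
      ((kr 4 (by omega)).trans h.one) k9 k10 (km ▸ ha) (km ▸ hb) hxa hyb hxy) ?_
    rintro s₅ ⟨hrep, hfr, hr⟩
    have hr' : ∀ r < 9, s₅.reg r = s.reg r := fun r h => (hr r h).trans (kr r (.inl h))
    refine (halts_flagProg hN ((hr' 2 (by omega)).trans h.left) ((hr' 3 (by omega)).trans h.right)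
      ((hr' 6 (by omega)).trans h.flag) ((hr' 7 (by omega)).trans h7)
      ((hr' 8 (by omega)).trans h8) hxy).mono le_rfl ?_
    rintro s₆ ⟨h6, hm, hfr', hr''⟩
    have hF := (kframe.trans hfr).trans hfr'
    refine ⟨⟨?_, ?_, ?_, ?_, ?_, h6, ?_, ?_, hm ▸ hrep⟩, hF⟩
    · rw [hr'' _ (by omega) (by omega), hr' _ (by omega), h.nodes]
    · rw [hr'' _ (by omega) (by omega), hr' _ (by omega), h.left]
    · rw [hr'' _ (by omega) (by omega), hr' _ (by omega), h.right]
    · rw [hr'' _ (by omega) (by omega), hr' _ (by omega), h.one]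
    · rw [hr'' _ (by omega) (by omega), hr' _ (by omega), h.zero]
    · rw [hF.reg _ (by omega), h.offset]
    · rw [hF.reg _ (by omega), h.two]

end Union

end SSSLocal

namespace SSSLocal

open Instr BinOp

/-- One step of the scan of the node in register `7`; register `19` counts down. -/
def scanBody : Prog :=
  .seq (block [op sub 19 19 4, nbr 8 7 19]) (.seq unionProg
    (.seq (block [op add 20 16 8, load 21 20, store 20 4]) (.ite 21 (block [const 19 0]) .skip)))

/-- Visit the node before the one in register `18`; register `17` holds the threshold. -/
def visitBody : Prog :=
  .seq (block [op sub 18 18 4, op add 7 18 5, deg 20 7, op lt 20 20 17, op add 21 16 7,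
    load 21 21, op add 20 20 21])
    (.ite 20 .skip (.seq (block [op add 21 16 7, store 21 4, op add 19 17 5]) (.loop 19 scanBody)))

/-- A sweep over all nodes, after which the threshold is halved. -/
def levelBody : Prog :=
  .seq (block [op add 18 0 5]) (.seq (.loop 18 visitBody) (block [op div 17 17 22]))

/-- The construction of the star forest. -/
def starProg : Prog := .seq (block [op add 17 0 5]) (.loop 17 levelBody)

/-- Read one random bit; register `19` is halved. -/
def bitBody : Prog := block [op div 19 19 22, bit 20, op add 23 23 23, op add 23 23 20]

/-- Sample one neighbour; register `1` holds the number of samples for each node. -/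
def sampleBody : Prog :=
  .seq (block [op sub 18 18 4, op div 7 18 1, op add 19 0 5, const 23 0]) (.seq (.loop 19 bitBody)
    (.seq (block [deg 20 7]) (.ite 20 (.seq (block [op mod 21 23 20, nbr 8 7 21]) unionProg) .skip)))

/-- All random samples. -/
def sampleProg : Prog := .seq (block [op mul 18 0 1]) (.loop 18 sampleBody)

/-- The answer, in register `0`. -/
def answerProg : Prog :=
  .seq (block [op add 9 2 5, op add 10 3 5]) (.seq (findProg 9) (.seq (findProg 10)
    (block [op eq 11 9 10, op sub 11 4 11, op add 0 6 11])))

/-- Cap register `1` by the number of nodes. -/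
def capProg : Prog :=
  .seq (block [const 4 1, op lt 20 0 1]) (.ite 20 (block [op add 1 0 5]) .skip)

/-- Multiply register `1` by `K` and by the square of the number of digits of `n`. -/
def setupProg (K : ℕ) : Prog :=
  .seq (block [const 22 2, op add 16 0 0, op add 19 0 5])
    (.seq (.loop 19 (block [op div 19 19 22, op add 21 21 4]))
      (block [const 20 K, op mul 1 1 20, op mul 1 1 21, op mul 1 1 21]))

/-- The program after the capping of register `1`. -/
def mainProg (K : ℕ) : Prog :=
  .seq (setupProg K) (.seq starProg (.seq sampleProg answerProg))

/-- The local computation algorithm. -/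
def sssProg (K : ℕ) : Prog := .seq capProg (mainProg K)

/-! ### Correctness and cost of the two forest stages and the answer -/

section Phases

variable {n : ℕ} {I : GraphInput n} {ω : ℕ → Bool} {N : ℕ}

/-- The covered nodes are marked in the memory. -/
def Marked (cov : Finset (Fin n)) (mem : ℕ → ℕ) : Prop :=
  ∀ x : Fin n, mem (2 * n + x) = if x ∈ cov then 1 else 0

theorem Marked.insert {cov : Finset (Fin n)} {mem : ℕ → ℕ} (h : Marked cov mem) (w : Fin n) :
    Marked (insert w cov) (Function.update mem (2 * n + w) 1) := by
  intro x
  by_cases hx : x = w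
  · subst hx
    simp
  · have : 2 * n + (x : ℕ) ≠ 2 * n + w := by
      rw [ne_eq, Nat.add_left_cancel_iff, Fin.val_inj]
      exact hx
    rw [Function.update_of_ne this, h x]
    simp [hx]

theorem Core.of_eq {F : SimpleGraph (Fin n)} {u v : Fin n} {s s' : State} (h : Core F u v s)
    (hr : ∀ r, r ≤ 6 ∧ r ≠ 1 ∨ r = 16 ∨ r = 22 → s'.reg r = s.reg r)
    (hm : ∀ a < 2 * n, s'.mem a = s.mem a) : Core F u v s' where
  nodes := (hr 0 (by omega)).trans h.nodes
  left := (hr 2 (by omega)).trans h.left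
  right := (hr 3 (by omega)).trans h.right
  one := (hr 4 (by omega)).trans h.one
  zero := (hr 5 (by omega)).trans h.zero
  flag := (hr 6 (by omega)).trans h.flag
  offset := (hr 16 (by omega)).trans h.offset
  two := (hr 22 (by omega)).trans h.two
  rep := h.rep.congr hm

/-- Each union is charged to the node it newly covers; the `1 +` pays for a last union that meets a
covered node. -/
theorem halts_scanLoop (hN : 4 * n + 4 ≤ N) {u v x : Fin n} (g : ℕ) (hg : g ≤ I.degree x)
    (σ : Finset (Fin n) × SimpleGraph (Fin n)) {s : State} (h : Core σ.2 u v s)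
    (hc : Marked σ.1 s.mem) (h7 : s.reg 7 = x) (h19 : s.reg 19 = g) :
    Halts I ω N (.loop 19 scanBody) s
      ((6 * n.size + 40) * (1 + ((I.scan x g σ).1.card - σ.1.card)) + 1) fun s' =>
      Core (I.scan x g σ).2 u v s' ∧ Marked (I.scan x g σ).1 s'.mem ∧
        (∀ r, r = 1 ∨ r = 17 ∨ r = 18 → s'.reg r = s.reg r) ∧ s'.pos = s.pos := by
  have hN' : n < N := by omega
  induction g generalizing σ s with
  | zero => exact .loopStop (by omega) h19 ⟨h, hc, fun _ _ => rfl, rfl⟩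
  | succ g ih =>
    set w := I.neighbor x g with hw
    have hnbr : I.nbrAt x g = w := I.nbrAt_val hg
    -- At a covered node register `19` is cleared, and only the closing loop test remains.
    set m₂ := if w ∈ σ.1 then 1 else
      (6 * n.size + 40) * (1 + ((I.scan x (g + 1) σ).1.card - (insert w σ.1).card)) + 1 with hm₂
    refine Halts.mono (m := 1 + (2 + ((6 * n.size + 28) + (3 + (1 + 1)))) + m₂)
      (.loopStep (by omega) (.seq (Halts.block hN' (by simp [BlockSafe, Safe]) ?_))) ?_
      fun _ h => h
    · set s₁ := blockExec I ω [op sub 19 19 4, nbr 8 7 19] s with hs₁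
      have e8 : s₁.reg 8 = w := by
        simp [hs₁, blockExec, exec, BinOp.eval, h7, h19, h.one, hnbr]
      have e19 : s₁.reg 19 = g := by
        simp [hs₁, blockExec, exec, BinOp.eval, h19, h.one]
      have em : s₁.mem = s.mem := by simp [hs₁, blockExec, exec]
      have ep : s₁.pos = s.pos := by simp [hs₁, blockExec, exec]
      have er : ∀ r, r ≠ 8 → r ≠ 19 → s₁.reg r = s.reg r := by
        intro r h1 h2
        simp [hs₁, blockExec, exec, h1, h2]
      refine .seq' (halts_unionProg hN (h.of_eq (fun r hr => er r (by omega) (by omega))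
        fun _ _ => by rw [em]) ((er 7 (by omega) (by omega)).trans h7) e8) ?_
      rintro s₂ ⟨hcore, hfr⟩
      have f8 : s₂.reg 8 = w := (hfr.reg 8 (by omega)).trans e8
      have f19 : s₂.reg 19 = g := (hfr.reg 19 (by omega)).trans e19
      have f7 : s₂.reg 7 = x := (hfr.reg 7 (by omega)).trans ((er 7 (by omega) (by omega)).trans h7)
      have fm : Marked σ.1 s₂.mem := fun y => by rw [hfr.mem _ (by omega), em, hc]
      have fr : ∀ r, r = 1 ∨ r = 17 ∨ r = 18 → s₂.reg r = s.reg r := fun r hr =>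
        (hfr.reg r (by omega)).trans (er r (by omega) (by omega))
      have fp : s₂.pos = s.pos := hfr.pos.trans ep
      refine .seq (Halts.block hN' ?_ ?_)
      · simp [BlockSafe, Safe, hcore.offset, f8]
        omega
      set s₃ := blockExec I ω [op add 20 16 8, load 21 20, store 20 4] s₂ with hs₃
      have g21 : s₃.reg 21 = if w ∈ σ.1 then 1 else 0 := by
        simp [hs₃, blockExec, exec, BinOp.eval, hcore.offset, f8, fm w]
      have gm : s₃.mem = Function.update s₂.mem (2 * n + w) 1 := by
        simp [hs₃, blockExec, exec, BinOp.eval, hcore.offset, f8, hcore.one]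
      have gr : ∀ r, r ≠ 20 → r ≠ 21 → s₃.reg r = s₂.reg r := by
        intro r h1 h2
        simp [hs₃, blockExec, exec, h1, h2]
      have gp : s₃.pos = s₂.pos := by simp [hs₃, blockExec, exec]
      have gmark : Marked (insert w σ.1) s₃.mem := gm ▸ fm.insert w
      have gcore : Core (addEdge σ.2 x w) u v s₃ :=
        hcore.of_eq (fun r hr => gr r (by omega) (by omega)) fun a ha => by
          rw [gm, Function.update_of_ne (by omega)]
      have gr' : ∀ r, r = 1 ∨ r = 17 ∨ r = 18 → s₃.reg r = s.reg r := fun r hr =>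
        (gr r (by omega) (by omega)).trans (fr r hr)
      by_cases hmem : w ∈ σ.1
      · have hscan : I.scan x (g + 1) σ = (σ.1, addEdge σ.2 x w) := by
          rw [GraphInput.scan, ← hw, if_pos hmem]
        rw [hscan, hm₂, if_pos hmem]
        refine .ite (fun _ => Halts.block hN' (by simp [BlockSafe, Safe]) ?_) fun h0 => ?_
        · set s₄ := blockExec I ω [const 19 0] s₃ with hs₄
          have kr : ∀ r, r ≠ 19 → s₄.reg r = s₃.reg r := by
            intro r h1
            simp [hs₄, blockExec, exec, h1]
          have km : s₄.mem = s₃.mem := by simp [hs₄, blockExec, exec]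
          refine .loopStop le_rfl (by simp [hs₄, blockExec, exec])
            ⟨gcore.of_eq (fun r hr => kr r (by omega)) fun _ _ => by rw [km], ?_,
              fun r hr => (kr r (by omega)).trans (gr' r hr), ?_⟩
          · rw [Finset.insert_eq_of_mem hmem] at gmark
            exact km ▸ gmark
          · simp [hs₄, blockExec, exec, gp, fp]
        · rw [g21, if_pos hmem] at h0
          exact absurd h0 one_ne_zero
      · have hscan : I.scan x (g + 1) σ = I.scan x g (insert w σ.1, addEdge σ.2 x w) := by
          rw [GraphInput.scan, ← hw, if_neg hmem]
        rw [hm₂, if_neg hmem, hscan]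
        refine .ite (fun h0 => ?_) fun _ => .skip ?_
        · rw [g21, if_neg hmem] at h0
          exact absurd rfl h0
        · refine (ih (by omega) (insert w σ.1, addEdge σ.2 x w) gcore gmark
            ((gr 7 (by omega) (by omega)).trans f7)
            ((gr 19 (by omega) (by omega)).trans f19)).mono le_rfl ?_
          rintro s' ⟨h1, h2, h3, h4⟩
          exact ⟨h1, h2, fun r hr => (h3 r hr).trans (gr' r hr), h4.trans (gp.trans fp)⟩
    · rw [hm₂]
      split_ifs with hmem
      · nlinarith
      · have h1 := Finset.card_insert_of_notMem hmem
        have h2 : (insert w σ.1).card ≤ (I.scan x (g + 1) σ).1.card := by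
          rw [GraphInput.scan, ← hw, if_neg hmem]
          exact Finset.card_le_card (I.subset_scan x g (insert w σ.1, addEdge σ.2 x w))
        obtain ⟨e, he⟩ := Nat.exists_eq_add_of_le h2
        rw [he, h1, show σ.1.card + 1 + e - σ.1.card = e + 1 by omega,
          show σ.1.card + 1 + e - (σ.1.card + 1) = e by omega]
        nlinarith

/-- The visited node becomes covered as well, and this pays for the extra union of its scan. Hence
the charges telescope over all visits and sweeps. -/
theorem halts_visitBody (hN : 4 * n + 4 ≤ N) {u v : Fin n} {T j : ℕ} (hj : j < n) (hT : T ≤ n)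
    (σ : Finset (Fin n) × SimpleGraph (Fin n)) {s : State} (h : Core σ.2 u v s)
    (hc : Marked σ.1 s.mem) (h17 : s.reg 17 = T) (h18 : s.reg 18 = j + 1) :
    Halts I ω N visitBody s
      ((6 * n.size + 40) * ((I.visit T ⟨j, hj⟩ σ).1.card - σ.1.card) + 12) fun s' =>
      Core (I.visit T ⟨j, hj⟩ σ).2 u v s' ∧ Marked (I.visit T ⟨j, hj⟩ σ).1 s'.mem ∧
        s'.reg 1 = s.reg 1 ∧ s'.reg 17 = T ∧ s'.reg 18 = j ∧ s'.pos = s.pos := by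
  have hN' : n < N := by omega
  set x : Fin n := ⟨j, hj⟩ with hx
  have hdeg : I.degAt j = I.degree x := I.degAt_val x
  have hmark : s.mem (2 * n + j) = if x ∈ σ.1 then 1 else 0 := hc x
  refine Halts.mono (m := 7 + (1 + ((6 * n.size + 40) * ((I.visit T x σ).1.card - σ.1.card) + 4)))
    (.seq (Halts.block hN' ?_ ?_)) (by omega) fun _ h => h
  · simp [BlockSafe, Safe, exec, BinOp.eval, h18, h.one, h.zero, h.offset, hmark]
    refine ⟨by omega, by omega, ?_⟩
    split_ifs <;> omega
  set s₁ := blockExec I ω [op sub 18 18 4, op add 7 18 5, deg 20 7, op lt 20 20 17, op add 21 16 7,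
    load 21 21, op add 20 20 21] s with hs₁
  have e7 : s₁.reg 7 = x := by simp [hs₁, blockExec, exec, BinOp.eval, h18, h.one, h.zero, hx]
  have e18 : s₁.reg 18 = j := by simp [hs₁, blockExec, exec, BinOp.eval, h18, h.one]
  -- Register `20` counts the reasons for not scanning.
  have e20 : s₁.reg 20 = (if I.degree x < T then 1 else 0) + if x ∈ σ.1 then 1 else 0 := by
    simp [hs₁, blockExec, exec, BinOp.eval, h18, h.one, h.zero, h.offset, h17, hdeg, hmark]
  have em : s₁.mem = s.mem := by simp [hs₁, blockExec, exec]
  have ep : s₁.pos = s.pos := by simp [hs₁, blockExec, exec]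
  have er : ∀ r, r ≠ 7 → r ≠ 18 → r ≠ 20 → r ≠ 21 → s₁.reg r = s.reg r := by
    intro r h1 h2 h3 h4
    simp [hs₁, blockExec, exec, h1, h2, h3, h4]
  have ecore : Core σ.2 u v s₁ := h.of_eq
    (fun r hr => er r (by omega) (by omega) (by omega) (by omega)) fun _ _ => by rw [em]
  have e17 : s₁.reg 17 = T := (er 17 (by omega) (by omega) (by omega) (by omega)).trans h17
  have e1 : s₁.reg 1 = s.reg 1 := er 1 (by omega) (by omega) (by omega) (by omega)
  refine .ite (fun h0 => .skip ?_) fun h0 => ?_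
  · have hcond : ¬(T ≤ I.degree x ∧ x ∉ σ.1) := by
      rintro ⟨h1, h2⟩
      exact h0 (by rw [e20, if_neg h1.not_gt, if_neg h2])
    rw [GraphInput.visit, if_neg hcond]
    exact ⟨ecore, em ▸ hc, e1, e17, e18, ep⟩
  · have hcond : T ≤ I.degree x ∧ x ∉ σ.1 := by
      rw [e20] at h0
      constructor
      · by_contra h1
        rw [if_pos (not_le.1 h1)] at h0
        omega
      · intro h1
        rw [if_pos h1] at h0
        omega
    rw [GraphInput.visit, if_pos hcond]
    have hcard := Finset.card_insert_of_notMem hcond.2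
    have hle := Finset.card_le_card (I.subset_scan x T (insert x σ.1, σ.2))
    refine Halts.mono (m := 3 + ((6 * n.size + 40) *
      (1 + ((I.scan x T (insert x σ.1, σ.2)).1.card - (insert x σ.1).card)) + 1))
      (.seq (Halts.block hN' ?_ ?_)) ?_ fun _ h => h
    · simp [BlockSafe, Safe, exec, BinOp.eval, ecore.zero, ecore.offset, e7, e17]
      omega
    · set s₂ := blockExec I ω [op add 21 16 7, store 21 4, op add 19 17 5] s₁ with hs₂
      have f19 : s₂.reg 19 = T := by simp [hs₂, blockExec, exec, BinOp.eval, e17, ecore.zero]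
      have fm : s₂.mem = Function.update s₁.mem (2 * n + x) 1 := by
        simp [hs₂, blockExec, exec, BinOp.eval, ecore.offset, e7, ecore.one]
      have fp : s₂.pos = s₁.pos := by simp [hs₂, blockExec, exec]
      have fr : ∀ r, r ≠ 19 → r ≠ 21 → s₂.reg r = s₁.reg r := by
        intro r h1 h2
        simp [hs₂, blockExec, exec, h1, h2]
      have fmark : Marked (insert x σ.1) s₂.mem := fm ▸ Marked.insert (em ▸ hc) x
      refine (halts_scanLoop hN T hcond.1 (insert x σ.1, σ.2) (ecore.of_eq
        (fun r hr => fr r (by omega) (by omega)) fun a ha => ?_) fmark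
        ((fr 7 (by omega) (by omega)).trans e7) f19).mono le_rfl ?_
      · rw [fm, Function.update_of_ne (by omega)]
      · rintro s' ⟨h1, h2, h3, h4⟩
        refine ⟨h1, h2, ?_, ?_, ?_, h4.trans (fp.trans ep)⟩
        · rw [h3 1 (by omega), fr 1 (by omega) (by omega), e1]
        · rw [h3 17 (by omega), fr 17 (by omega) (by omega), e17]
        · rw [h3 18 (by omega), fr 18 (by omega) (by omega), e18]
    · have e : ∀ a b : ℕ, b + 1 ≤ a → 1 + (a - (b + 1)) = a - b := by omega
      simp only [hcard] at hle ⊢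
      rw [e _ _ hle]
      omega

theorem halts_sweepLoop (hN : 4 * n + 4 ≤ N) {u v : Fin n} {T : ℕ} (hT : T ≤ n) (j : ℕ)
    (hj : j ≤ n) (σ : Finset (Fin n) × SimpleGraph (Fin n)) {s : State} (h : Core σ.2 u v s)
    (hc : Marked σ.1 s.mem) (h17 : s.reg 17 = T) (h18 : s.reg 18 = j) :
    Halts I ω N (.loop 18 visitBody) s
      ((6 * n.size + 40) * ((I.sweep T j σ).1.card - σ.1.card) + 13 * j + 1) fun s' =>
      Core (I.sweep T j σ).2 u v s' ∧ Marked (I.sweep T j σ).1 s'.mem ∧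
        s'.reg 1 = s.reg 1 ∧ s'.reg 17 = T ∧ s'.pos = s.pos := by
  induction j generalizing σ s with
  | zero => exact .loopStop (by omega) h18 ⟨h, hc, rfl, h17, rfl⟩
  | succ j ih =>
    have hj' : j < n := hj
    set τ := I.visit T ⟨j, hj'⟩ σ with hτ
    have hsweep : I.sweep T (j + 1) σ = I.sweep T j τ := by
      rw [GraphInput.sweep, dif_pos hj']
    have hle : σ.1.card ≤ τ.1.card := Finset.card_le_card (I.subset_visit _ _ _)
    have hle' : τ.1.card ≤ (I.sweep T j τ).1.card := Finset.card_le_card (I.subset_sweep _ _ _)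
    rw [hsweep]
    refine Halts.mono (m := 1 + ((6 * n.size + 40) * (τ.1.card - σ.1.card) + 12) +
      ((6 * n.size + 40) * ((I.sweep T j τ).1.card - τ.1.card) + 13 * j + 1))
      (.loopStep (by omega) ((halts_visitBody hN hj' hT σ h hc h17 h18).mono le_rfl ?_)) ?_
      fun _ h => h
    · rintro s₁ ⟨h1, h2, h3, h4, h5, h6⟩
      refine (ih (by omega) τ h1 h2 h4 h5).mono le_rfl ?_
      rintro s' ⟨k1, k2, k3, k4, k5⟩
      exact ⟨k1, k2, k3.trans h3, k4, k5.trans h6⟩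
    · have e : (I.sweep T j τ).1.card - σ.1.card =
          (τ.1.card - σ.1.card) + ((I.sweep T j τ).1.card - τ.1.card) := by omega
      rw [e, mul_add]
      omega

/-- The threshold `n / 2 ^ i` vanishes exactly from `i = n.size` on, so it serves as its own loop
counter. -/
theorem halts_levelLoop (hN : 4 * n + 4 ≤ N) {u v : Fin n} (d i : ℕ) (hi : i + d = n.size)
    {s : State} (h : Core (I.level i).2 u v s) (hc : Marked (I.level i).1 s.mem)
    (h17 : s.reg 17 = n / 2 ^ i) :
    Halts I ω N (.loop 17 levelBody) s
      ((6 * n.size + 40) * ((I.level n.size).1.card - (I.level i).1.card) + (13 * n + 4) * d + 1)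
      fun s' => Core I.starForest u v s' ∧ s'.reg 1 = s.reg 1 ∧ s'.pos = s.pos := by
  have hN' : n < N := by omega
  induction d generalizing i s with
  | zero =>
    have hi' : i = n.size := hi
    subst hi'
    refine .loopStop (by omega) ?_ ⟨h, rfl, rfl⟩
    rw [h17]
    exact Nat.div_eq_of_lt (Nat.lt_size_self n)
  | succ d ih =>
    have hpos : s.reg 17 ≠ 0 := by
      rw [h17]
      exact (Nat.div_pos (Nat.lt_size.1 (by omega)) (by positivity)).ne'
    have hlev : I.sweep (n / 2 ^ i) n (I.level i) = I.level (i + 1) := rfl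
    refine Halts.mono (m := 1 + (1 + (((6 * n.size + 40) *
      ((I.level (i + 1)).1.card - (I.level i).1.card) + 13 * n + 1) + 1)) +
      ((6 * n.size + 40) * ((I.level n.size).1.card - (I.level (i + 1)).1.card) +
        (13 * n + 4) * d + 1))
      (.loopStep hpos (.seq (Halts.block hN' ?_ ?_))) ?_ fun _ h => h
    · simp [BlockSafe, Safe, h.nodes, h.zero]
      omega
    · set s₁ := blockExec I ω [op add 18 0 5] s with hs₁
      have em : s₁.mem = s.mem := by simp [hs₁, blockExec, exec]
      have ep : s₁.pos = s.pos := by simp [hs₁, blockExec, exec]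
      have er : ∀ r, r ≠ 18 → s₁.reg r = s.reg r := by
        intro r h1
        simp [hs₁, blockExec, exec, h1]
      have e18 : s₁.reg 18 = n := by simp [hs₁, blockExec, exec, BinOp.eval, h.nodes, h.zero]
      rw [← hlev]
      refine .seq' (halts_sweepLoop hN (Nat.div_le_self _ _) n le_rfl (I.level i)
        (h.of_eq (fun r hr => er r (by omega)) fun _ _ => by rw [em]) (em ▸ hc)
        ((er 17 (by omega)).trans h17) e18) ?_
      rw [hlev]
      rintro s₂ ⟨k1, k2, k3, k4, k5⟩
      refine Halts.block hN' (by simp [BlockSafe, Safe]) ?_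
      set s₃ := blockExec I ω [op div 17 17 22] s₂ with hs₃
      have gm : s₃.mem = s₂.mem := by simp [hs₃, blockExec, exec]
      have gp : s₃.pos = s₂.pos := by simp [hs₃, blockExec, exec]
      have gr : ∀ r, r ≠ 17 → s₃.reg r = s₂.reg r := by
        intro r h1
        simp [hs₃, blockExec, exec, h1]
      have g17 : s₃.reg 17 = n / 2 ^ (i + 1) := by
        simp [hs₃, blockExec, exec, BinOp.eval, k4, k1.two, Nat.div_div_eq_div_mul, pow_succ]
      refine (ih (i + 1) (by omega) (k1.of_eq (fun r hr => gr r (by omega))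
        fun _ _ => by rw [gm]) (gm ▸ k2) g17).mono le_rfl ?_
      rintro s' ⟨l1, l2, l3⟩
      refine ⟨l1, ?_, ?_⟩
      · rw [l2, gr 1 (by omega), k3, er 1 (by omega)]
      · rw [l3, gp, k5, ep]
    · have h1 := Finset.card_le_card (I.level_subset (Nat.le_succ i))
      have h2 := Finset.card_le_card (I.level_subset (show i + 1 ≤ n.size by omega))
      have e : (I.level n.size).1.card - (I.level i).1.card =
          ((I.level (i + 1)).1.card - (I.level i).1.card) +
            ((I.level n.size).1.card - (I.level (i + 1)).1.card) := by
        rw [Nat.succ_eq_add_one] at h1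
        omega
      rw [e, mul_add, mul_add (13 * n + 4)]
      omega

theorem halts_starProg (hN : 4 * n + 4 ≤ N) {u v : Fin n} {s : State}
    (h : Core (⊥ : SimpleGraph (Fin n)) u v s) (hc : Marked (∅ : Finset (Fin n)) s.mem) :
    Halts I ω N starProg s ((6 * n.size + 40) * n + (13 * n + 4) * n.size + 2) fun s' =>
      Core I.starForest u v s' ∧ s'.reg 1 = s.reg 1 ∧ s'.pos = s.pos := by
  have hN' : n < N := by omega
  refine Halts.mono (m := 1 + ((6 * n.size + 40) * ((I.level n.size).1.card -
    (I.level 0).1.card) + (13 * n + 4) * n.size + 1)) (.seq (Halts.block hN' ?_ ?_)) ?_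
    fun _ h => h
  · simp [BlockSafe, Safe, h.nodes, h.zero]
    omega
  · set s₁ := blockExec I ω [op add 17 0 5] s with hs₁
    have em : s₁.mem = s.mem := by simp [hs₁, blockExec, exec]
    have ep : s₁.pos = s.pos := by simp [hs₁, blockExec, exec]
    have er : ∀ r, r ≠ 17 → s₁.reg r = s.reg r := by
      intro r h1
      simp [hs₁, blockExec, exec, h1]
    have e17 : s₁.reg 17 = n / 2 ^ 0 := by
      simp [hs₁, blockExec, exec, BinOp.eval, h.nodes, h.zero]
    refine (halts_levelLoop hN n.size 0 (zero_add _) (h.of_eq (fun r hr => er r (by omega))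
      fun _ _ => by rw [em]) (em ▸ hc) e17).mono le_rfl ?_
    rintro s' ⟨h1, h2, h3⟩
    exact ⟨h1, h2.trans (er 1 (by omega)), h3.trans ep⟩
  · have h1 : (I.level n.size).1.card - (I.level 0).1.card ≤ n :=
      (Nat.sub_le _ _).trans ((Finset.card_le_univ _).trans (by simp))
    have := Nat.mul_le_mul_left (6 * n.size + 40) h1
    omega

theorem halts_bitLoop (hN : 4 * n + 4 ≤ N) (d i p : ℕ) (hi : i + d = n.size) {s : State}
    (h22 : s.reg 22 = 2) (h19 : s.reg 19 = n / 2 ^ i) (h23 : s.reg 23 = blockVal ω p i)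
    (hp : s.pos = p + i) :
    Halts I ω N (.loop 19 bitBody) s (5 * d + 1) fun s' =>
      s'.reg 23 = blockVal ω p n.size ∧ s'.mem = s.mem ∧ s'.pos = p + n.size ∧
        ∀ r, r ≠ 19 → r ≠ 20 → r ≠ 23 → s'.reg r = s.reg r := by
  have hN' : n < N := by omega
  induction d generalizing i s with
  | zero =>
    have hi' : i = n.size := hi
    subst hi'
    refine .loopStop (by omega) ?_ ⟨h23, rfl, hp, fun _ _ _ _ => rfl⟩
    rw [h19]
    exact Nat.div_eq_of_lt (Nat.lt_size_self n)
  | succ d ih =>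
    -- Before the last bit the number read is below `2 ^ i ≤ n`, so doubling it stays within the
    -- bound `N`.
    have hle : 2 ^ i ≤ n := Nat.lt_size.1 (by omega)
    have hpos : s.reg 19 ≠ 0 := by
      rw [h19]
      exact (Nat.div_pos hle (by positivity)).ne'
    have hval := blockVal_lt ω p i
    have hbit := Bool.toNat_le (ω (p + i))
    refine Halts.mono (m := 1 + 4 + (5 * d + 1)) (.loopStep hpos (Halts.block hN' ?_ ?_)) (by omega)
      fun _ h => h
    · simp [BlockSafe, Safe, exec, BinOp.eval, h23, hp]
      omega
    · set s₁ := blockExec I ω [op div 19 19 22, bit 20, op add 23 23 23, op add 23 23 20] s with hs₁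
      have em : s₁.mem = s.mem := by simp [hs₁, blockExec, exec]
      have ep : s₁.pos = p + (i + 1) := by simp [hs₁, blockExec, exec, hp, add_assoc]
      have er : ∀ r, r ≠ 19 → r ≠ 20 → r ≠ 23 → s₁.reg r = s.reg r := by
        intro r h1 h2 h3
        simp [hs₁, blockExec, exec, h1, h2, h3]
      have e19 : s₁.reg 19 = n / 2 ^ (i + 1) := by
        simp [hs₁, blockExec, exec, BinOp.eval, h19, h22, Nat.div_div_eq_div_mul, pow_succ]
      have e23 : s₁.reg 23 = blockVal ω p (i + 1) := by
        simp [hs₁, blockExec, exec, BinOp.eval, h23, hp, blockVal, two_mul]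
      refine (ih (i + 1) (by omega) ((er 22 (by omega) (by omega) (by omega)).trans h22) e19 e23
        ep).mono le_rfl ?_
      rintro s' ⟨h1, h2, h3, h4⟩
      exact ⟨h1, h2.trans em, h3, fun r a b c => (h4 r a b c).trans (er r a b c)⟩

/-- A single counter runs down from `n * k`, and dividing it by `k` gives the node. A block is read
even for an isolated node, so sample `j` always starts at tape position `j * n.size`. -/
theorem halts_sampleBody (hN : 4 * n + 4 ≤ N) {u v : Fin n} {k j : ℕ} (hj : j < n * k)
    {s : State} (h : Core (I.sampleForest ω k j) u v s) (h1 : s.reg 1 = k)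
    (h18 : s.reg 18 = n * k - j) (hp : s.pos = j * n.size) :
    Halts I ω N sampleBody s (11 * n.size + 38) fun s' =>
      Core (I.sampleForest ω k (j + 1)) u v s' ∧ s'.reg 1 = k ∧
        s'.reg 18 = n * k - (j + 1) ∧ s'.pos = (j + 1) * n.size := by
  have hN' : n < N := by omega
  have hlt : (n * k - 1 - j) / k < n := by
    rw [Nat.div_lt_iff_lt_mul (Nat.pos_of_mul_pos_left (by omega : 0 < n * k))]
    omega
  set x : Fin n := ⟨_, hlt⟩ with hx
  set w := I.neighbor x (blockVal ω (j * n.size) n.size % I.degree x) with hw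
  have hF : I.sampleForest ω k (j + 1) = addEdge (I.sampleForest ω k j) x w := by
    rw [GraphInput.sampleForest, dif_pos hlt]
  rw [hF]
  refine Halts.mono (m := 4 + ((5 * n.size + 1) + (1 + (1 + (2 + (6 * n.size + 28))))))
    (.seq (Halts.block hN' ?_ ?_)) (by omega) fun _ h => h
  · simp [BlockSafe, Safe, exec, h.nodes, h.zero]
    omega
  set s₁ := blockExec I ω [op sub 18 18 4, op div 7 18 1, op add 19 0 5, const 23 0] s with hs₁
  have em : s₁.mem = s.mem := by simp [hs₁, blockExec, exec]
  have ep : s₁.pos = j * n.size := by simp [hs₁, blockExec, exec, hp]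
  have er : ∀ r, r ≠ 7 → r ≠ 18 → r ≠ 19 → r ≠ 23 → s₁.reg r = s.reg r := by
    intro r h1 h2 h3 h4
    simp [hs₁, blockExec, exec, h1, h2, h3, h4]
  have e18 : s₁.reg 18 = n * k - (j + 1) := by
    simp [hs₁, blockExec, exec, BinOp.eval, h18, h.one, Nat.sub_sub]
  have e7 : s₁.reg 7 = x := by
    simp [hs₁, blockExec, exec, BinOp.eval, h18, h.one, h1, hx, Nat.sub_right_comm]
  have e19 : s₁.reg 19 = n / 2 ^ 0 := by
    simp [hs₁, blockExec, exec, BinOp.eval, h.nodes, h.zero]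
  have e23 : s₁.reg 23 = blockVal ω (j * n.size) 0 := by simp [hs₁, blockExec, exec, blockVal]
  refine .seq' (halts_bitLoop hN n.size 0 (j * n.size) (zero_add _)
    ((er 22 (by omega) (by omega) (by omega) (by omega)).trans h.two) e19 e23 ep) ?_
  rintro s₂ ⟨f23, fm, fp, fr⟩
  have fcore : Core (I.sampleForest ω k j) u v s₂ := h.of_eq
    (fun r hr => (fr r (by omega) (by omega) (by omega)).trans
      (er r (by omega) (by omega) (by omega) (by omega))) fun _ _ => by rw [fm, em]
  have f7 : s₂.reg 7 = x := (fr 7 (by omega) (by omega) (by omega)).trans e7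
  refine .seq (Halts.block hN' (by simp [BlockSafe, Safe]) ?_)
  set s₃ := blockExec I ω [deg 20 7] s₂ with hs₃
  have gm : s₃.mem = s₂.mem := by simp [hs₃, blockExec, exec]
  have gp : s₃.pos = s₂.pos := by simp [hs₃, blockExec, exec]
  have gr : ∀ r, r ≠ 20 → s₃.reg r = s₂.reg r := by
    intro r h1
    simp [hs₃, blockExec, exec, h1]
  have g20 : s₃.reg 20 = I.degree x := by
    simp [hs₃, blockExec, exec, f7, I.degAt_val]
  have gcore : Core (I.sampleForest ω k j) u v s₃ := fcore.of_eq (fun r hr => gr r (by omega))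
    fun _ _ => by rw [gm]
  have g1 : s₃.reg 1 = k := by
    rw [gr 1 (by omega), fr 1 (by omega) (by omega) (by omega),
      er 1 (by omega) (by omega) (by omega) (by omega), h1]
  have g18 : s₃.reg 18 = n * k - (j + 1) := by
    rw [gr 18 (by omega), fr 18 (by omega) (by omega) (by omega), e18]
  have gp' : s₃.pos = (j + 1) * n.size := by
    rw [gp, fp]
    ring
  refine .ite (fun h0 => ?_) fun h0 => .skip ?_
  · rw [g20] at h0
    refine .seq (Halts.block hN' (by simp [BlockSafe, Safe]) ?_)
    set s₄ := blockExec I ω [op mod 21 23 20, nbr 8 7 21] s₃ with hs₄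
    have km : s₄.mem = s₃.mem := by simp [hs₄, blockExec, exec]
    have kp : s₄.pos = s₃.pos := by simp [hs₄, blockExec, exec]
    have kr : ∀ r, r ≠ 8 → r ≠ 21 → s₄.reg r = s₃.reg r := by
      intro r h1 h2
      simp [hs₄, blockExec, exec, h1, h2]
    have g7 : s₃.reg 7 = x := (gr 7 (by omega)).trans f7
    have g23 : s₃.reg 23 = blockVal ω (j * n.size) n.size := (gr 23 (by omega)).trans f23
    have k8 : s₄.reg 8 = w := by
      rw [hw, ← I.nbrAt_val (Nat.mod_lt _ (Nat.pos_of_ne_zero h0))]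
      simp [hs₄, blockExec, exec, BinOp.eval, g7, g23, g20]
    refine (halts_unionProg hN (gcore.of_eq (fun r hr => kr r (by omega) (by omega))
      fun _ _ => by rw [km]) ((kr 7 (by omega) (by omega)).trans g7) k8).mono le_rfl ?_
    rintro s' ⟨hcore, hfr⟩
    refine ⟨hcore, ?_, ?_, ?_⟩
    · rw [hfr.reg 1 (by omega), kr 1 (by omega) (by omega), g1]
    · rw [hfr.reg 18 (by omega), kr 18 (by omega) (by omega), g18]
    · rw [hfr.pos, kp, gp']
  · rw [g20] at h0
    -- For degree 0 every number is out of range, so the mathematical forest does not change either.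
    have hwx : w = x := I.neighbor_of_le (by omega)
    rw [hwx, addEdge_of_reachable (.refl x)]
    exact ⟨gcore, g1, g18, gp'⟩

theorem halts_sampleLoop (hN : 4 * n + 4 ≤ N) {u v : Fin n} {k : ℕ} (d j : ℕ)
    (hj : j + d = n * k) {s : State} (h : Core (I.sampleForest ω k j) u v s) (h1 : s.reg 1 = k)
    (h18 : s.reg 18 = n * k - j) (hp : s.pos = j * n.size) :
    Halts I ω N (.loop 18 sampleBody) s ((11 * n.size + 39) * d + 1) fun s' =>
      Core (I.sampleForest ω k (n * k)) u v s' := by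
  induction d generalizing j s with
  | zero =>
    have hj' : j = n * k := hj
    subst hj'
    exact .loopStop (by omega) (by omega) h
  | succ d ih =>
    refine Halts.mono (m := 1 + (11 * n.size + 38) + ((11 * n.size + 39) * d + 1))
      (.loopStep (by omega) ((halts_sampleBody hN (by omega) h h1 h18 hp).mono le_rfl ?_))
      (by rw [mul_add (11 * n.size + 39)]; omega) fun _ h => h
    rintro s₁ ⟨k1, k2, k3, k4⟩
    exact ih (j + 1) (by omega) k1 k2 k3 k4

theorem halts_sampleProg (hN : 4 * n + 4 ≤ N) {u v : Fin n} {k : ℕ} (hk : n * k ≤ N) {s : State}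
    (h : Core I.starForest u v s) (h1 : s.reg 1 = k) (hp : s.pos = 0) :
    Halts I ω N sampleProg s ((11 * n.size + 39) * (n * k) + 2) fun s' =>
      Core (I.sampleForest ω k (n * k)) u v s' := by
  have hN' : n < N := by omega
  refine Halts.mono (m := 1 + ((11 * n.size + 39) * (n * k) + 1)) (.seq (Halts.block hN' ?_ ?_))
    (by omega) fun _ h => h
  · simpa [BlockSafe, Safe, h.nodes, h1] using hk
  · set s₁ := blockExec I ω [op mul 18 0 1] s with hs₁
    have em : s₁.mem = s.mem := by simp [hs₁, blockExec, exec]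
    have ep : s₁.pos = 0 * n.size := by simp [hs₁, blockExec, exec, hp]
    have er : ∀ r, r ≠ 18 → s₁.reg r = s.reg r := by
      intro r h1
      simp [hs₁, blockExec, exec, h1]
    have e18 : s₁.reg 18 = n * k - 0 := by simp [hs₁, blockExec, exec, BinOp.eval, h.nodes, h1]
    exact halts_sampleLoop hN (n * k) 0 (zero_add _) (h.of_eq (fun r hr => er r (by omega))
      fun _ _ => by rw [em]) ((er 1 (by omega)).trans h1) e18 ep

open Classical in
theorem halts_answerProg (hN : 4 * n + 4 ≤ N) {F : SimpleGraph (Fin n)} {u v : Fin n} {s : State}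
    (h : Core F u v s) :
    Halts I ω N answerProg s (6 * n.size + 9) fun s' =>
      s'.reg 0 ≠ 0 ↔ F.Adj u v ∨ ¬F.Reachable u v := by
  have hN' : n < N := by omega
  refine Halts.mono (m := 2 + ((3 * n.size + 2) + ((3 * n.size + 2) + 3)))
    (.seq (Halts.block hN' ?_ ?_)) (by omega) fun _ h => h
  · simp [BlockSafe, Safe, exec, h.left, h.right, h.zero]
    omega
  set s₁ := blockExec I ω [op add 9 2 5, op add 10 3 5] s with hs₁
  have em : s₁.mem = s.mem := by simp [hs₁, blockExec, exec]
  have er : ∀ r < 9, s₁.reg r = s.reg r := by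
    intro r hr
    have h1 : r ≠ 9 := by omega
    have h2 : r ≠ 10 := by omega
    simp [hs₁, blockExec, exec, h1, h2]
  have e9 : s₁.reg 9 = u := by simp [hs₁, blockExec, exec, BinOp.eval, h.left, h.zero]
  have e10 : s₁.reg 10 = v := by simp [hs₁, blockExec, exec, BinOp.eval, h.right, h.zero]
  refine .seq' (halts_findProg hN' (by omega) (by omega) (em ▸ h.rep)
    ((er 4 (by omega)).trans h.one) e9) ?_
  rintro s₂ ⟨a, ha, hua, f9, fm, -, fr⟩
  refine .seq' (halts_findProg hN' (by omega) (by omega) (fm ▸ em ▸ h.rep)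
    (((fr 4 (by omega) (by omega)).trans (er 4 (by omega))).trans h.one)
    ((fr 10 (by omega) (by omega)).trans e10)) ?_
  rintro s₃ ⟨b, hb, hvb, g10, -, -, gr⟩
  rw [em] at ha
  rw [fm, em] at hb
  have g9 : s₃.reg 9 = a := (gr 9 (by omega) (by omega)).trans f9
  have gr' : ∀ r < 9, s₃.reg r = s.reg r := fun r hr =>
    (gr r (by omega) (by omega)).trans ((fr r (by omega) (by omega)).trans (er r hr))
  have g4 : s₃.reg 4 = 1 := (gr' 4 (by omega)).trans h.one
  have g6 := (gr' 6 (by omega)).trans h.flag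
  have hab : F.Reachable u v ↔ a = b :=
    ⟨fun hr => h.rep.root_unique a b ha hb (hua.symm.trans (hr.trans hvb)),
      fun e => hua.trans (e ▸ hvb.symm)⟩
  refine Halts.block hN' ?_ ?_
  · simp [BlockSafe, Safe, exec, BinOp.eval, g4, g6, g9, g10]
    split_ifs <;> omega
  · simp [blockExec, exec, BinOp.eval, g4, g6, g9, g10, hab, Fin.val_inj]
    by_cases h1 : F.Adj u v <;> by_cases h2 : a = b <;> simp [h1, h2]

end Phases

end SSSLocal

namespace SSSLocal

open Instr BinOp

/-! ### Initialisation and capping of the parameter -/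

section Setup

variable {n : ℕ} {I : GraphInput n} {ω : ℕ → Bool} {N : ℕ}

theorem size_le_self (n : ℕ) : n.size ≤ n := Nat.size_le.2 Nat.lt_two_pow_self

theorem halts_sizeLoop (hN : 4 * n + 4 ≤ N) (d i : ℕ) (hi : i + d = n.size) {s : State}
    (h4 : s.reg 4 = 1) (h22 : s.reg 22 = 2) (h19 : s.reg 19 = n / 2 ^ i) (h21 : s.reg 21 = i) :
    Halts I ω N (.loop 19 (block [op div 19 19 22, op add 21 21 4])) s (3 * d + 1) fun s' =>
      s'.reg 21 = n.size ∧ s'.mem = s.mem ∧ s'.pos = s.pos ∧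
        ∀ r, r ≠ 19 → r ≠ 21 → s'.reg r = s.reg r := by
  have hN' : n < N := by omega
  have hsize := size_le_self n
  induction d generalizing i s with
  | zero =>
    have hi' : i = n.size := hi
    subst hi'
    refine .loopStop (by omega) ?_ ⟨h21, rfl, rfl, fun _ _ _ => rfl⟩
    rw [h19]
    exact Nat.div_eq_of_lt (Nat.lt_size_self n)
  | succ d ih =>
    have hpos : s.reg 19 ≠ 0 := by
      rw [h19]
      exact (Nat.div_pos (Nat.lt_size.1 (by omega)) (by positivity)).ne'
    refine Halts.mono (m := 1 + 2 + (3 * d + 1)) (.loopStep hpos (Halts.block hN' ?_ ?_)) (by omega)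
      fun _ h => h
    · simp [BlockSafe, Safe, exec, h21, h4]
      omega
    · set s₁ := blockExec I ω [op div 19 19 22, op add 21 21 4] s with hs₁
      have em : s₁.mem = s.mem := by simp [hs₁, blockExec, exec]
      have ep : s₁.pos = s.pos := by simp [hs₁, blockExec, exec]
      have er : ∀ r, r ≠ 19 → r ≠ 21 → s₁.reg r = s.reg r := by
        intro r h1 h2
        simp [hs₁, blockExec, exec, h1, h2]
      have e19 : s₁.reg 19 = n / 2 ^ (i + 1) := by
        simp [hs₁, blockExec, exec, BinOp.eval, h19, h22, Nat.div_div_eq_div_mul, pow_succ]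
      have e21 : s₁.reg 21 = i + 1 := by simp [hs₁, blockExec, exec, BinOp.eval, h21, h4]
      refine (ih (i + 1) (by omega) ((er 4 (by omega) (by omega)).trans h4)
        ((er 22 (by omega) (by omega)).trans h22) e19 e21).mono le_rfl ?_
      rintro s' ⟨h1, h2, h3, h4⟩
      exact ⟨h1, h2.trans em, h3.trans ep, fun r a b => (h4 r a b).trans (er r a b)⟩

/-- The state after the capping of register `1`. -/
structure Started (u v : Fin n) (q : ℕ) (s : State) : Prop where
  nodes : s.reg 0 = n
  param : s.reg 1 = q
  left : s.reg 2 = u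
  right : s.reg 3 = v
  one : s.reg 4 = 1
  rest : ∀ r, 4 < r → r ≠ 20 → s.reg r = 0
  tmp : s.reg 20 ≤ 1
  mem : s.mem = fun _ => 0
  pos : s.pos = 0

theorem halts_setupProg {K q : ℕ} (hN : 4 * n + 4 ≤ N) (hK : K ≤ N)
    (hN' : q * K * n.size * n.size ≤ N) {u v : Fin n} {s : State} (h : Started u v q s) :
    Halts I ω N (setupProg K) s (3 * n.size + 8) fun s' =>
      Core (⊥ : SimpleGraph (Fin n)) u v s' ∧ s'.reg 1 = q * K * n.size * n.size ∧
        s'.mem = (fun _ => 0) ∧ s'.pos = 0 := by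
  have hn : n < N := by omega
  have hL : 0 < n.size := Nat.size_pos.2 u.pos
  have hN₁ : q * K * n.size ≤ N := (Nat.le_mul_of_pos_right _ hL).trans hN'
  have hN₂ : q * K ≤ N := (Nat.le_mul_of_pos_right _ hL).trans hN₁
  refine Halts.mono (m := 3 + ((3 * n.size + 1) + 4)) (.seq (Halts.block hn ?_ ?_)) (by omega)
    fun _ h => h
  · simp [BlockSafe, Safe, exec, h.nodes, h.rest]
    omega
  set s₁ := blockExec I ω [const 22 2, op add 16 0 0, op add 19 0 5] s with hs₁
  have em : s₁.mem = s.mem := by simp [hs₁, blockExec, exec]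
  have ep : s₁.pos = s.pos := by simp [hs₁, blockExec, exec]
  have er : ∀ r, r ≠ 16 → r ≠ 19 → r ≠ 22 → s₁.reg r = s.reg r := by
    intro r h1 h2 h3
    simp [hs₁, blockExec, exec, h1, h2, h3]
  have e16 : s₁.reg 16 = 2 * n := by simp [hs₁, blockExec, exec, BinOp.eval, h.nodes, two_mul]
  have e19 : s₁.reg 19 = n / 2 ^ 0 := by simp [hs₁, blockExec, exec, BinOp.eval, h.nodes, h.rest]
  have e22 : s₁.reg 22 = 2 := by simp [hs₁, blockExec, exec]
  refine .seq' (halts_sizeLoop hN n.size 0 (zero_add _)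
    ((er 4 (by omega) (by omega) (by omega)).trans h.one) e22 e19
    ((er 21 (by omega) (by omega) (by omega)).trans (h.rest 21 (by omega) (by omega)))) ?_
  rintro s₂ ⟨f21, fm, fp, fr⟩
  have f1 : s₂.reg 1 = q := by
    rw [fr 1 (by omega) (by omega), er 1 (by omega) (by omega) (by omega), h.param]
  refine Halts.block hn ?_ ?_
  · simp [BlockSafe, Safe, exec, BinOp.eval, f1, f21, hK, hN₁, hN₂, hN']
  · set s₃ := blockExec I ω [const 20 K, op mul 1 1 20, op mul 1 1 21, op mul 1 1 21] s₂ with hs₃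
    have gm : s₃.mem = fun _ => 0 := by
      have : s₃.mem = s₂.mem := by simp [hs₃, blockExec, exec]
      rw [this, fm, em, h.mem]
    have gp : s₃.pos = 0 := by
      have : s₃.pos = s₂.pos := by simp [hs₃, blockExec, exec]
      rw [this, fp, ep, h.pos]
    have g1 : s₃.reg 1 = q * K * n.size * n.size := by
      simp [hs₃, blockExec, exec, BinOp.eval, f1, f21]
    have gr : ∀ r, r ≠ 1 → r ≠ 20 → r ≠ 19 → r ≠ 21 → s₃.reg r = s₁.reg r := by
      intro r h1 h2 h3 h4
      simp [hs₃, blockExec, exec, h1, h2, fr r h3 h4]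
    have gr' : ∀ r, r ≠ 1 → r < 16 → s₃.reg r = s.reg r := fun r h1 h2 =>
      (gr r h1 (by omega) (by omega) (by omega)).trans (er r (by omega) (by omega) (by omega))
    refine ⟨⟨?_, ?_, ?_, ?_, ?_, ?_, ?_, ?_, gm ▸ Rep.init⟩, g1, gm, gp⟩
    · rw [gr' 0 (by omega) (by omega), h.nodes]
    · rw [gr' 2 (by omega) (by omega), h.left]
    · rw [gr' 3 (by omega) (by omega), h.right]
    · rw [gr' 4 (by omega) (by omega), h.one]
    · rw [gr' 5 (by omega) (by omega), h.rest 5 (by omega) (by omega)]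
    · rw [gr' 6 (by omega) (by omega), h.rest 6 (by omega) (by omega)]
      simp
    · rw [gr 16 (by omega) (by omega) (by omega) (by omega), e16]
    · rw [gr 22 (by omega) (by omega) (by omega) (by omega), e22]

theorem halts_mainProg {K q : ℕ} (hN : 4 * n + 4 ≤ N) (hK : K ≤ N)
    (hN' : n * (q * K * n.size * n.size) ≤ N) {u v : Fin n} {s : State} (h : Started u v q s) :
    Halts I ω N (mainProg K) s
      ((3 * n.size + 8) + (((6 * n.size + 40) * n + (13 * n + 4) * n.size + 2) +
        (((11 * n.size + 39) * (n * (q * K * n.size * n.size)) + 2) + (6 * n.size + 9)))) fun s' =>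
      s'.reg 0 ≠ 0 ↔
        (I.sampleForest ω (q * K * n.size * n.size) (n * (q * K * n.size * n.size))).Adj u v ∨
        ¬(I.sampleForest ω (q * K * n.size * n.size)
          (n * (q * K * n.size * n.size))).Reachable u v := by
  refine .seq' (halts_setupProg hN hK ((Nat.le_mul_of_pos_left _ u.pos).trans hN') h) ?_
  rintro s₁ ⟨h1, h2, h3, h4⟩
  refine .seq' (halts_starProg hN h1 fun x => by simp [h3]) ?_
  rintro s₂ ⟨k1, k2, k3⟩
  exact .seq' (halts_sampleProg hN hN' k1 (k2.trans h2) (k3.trans h4))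
    fun s₃ l1 => halts_answerProg hN l1

/-- This phase is run by hand instead of through `Halts`, because `⌈1 / ε⌉` has no bound in terms of
`n`; its digits are charged once, here. -/
theorem exec_capProg {ε : ℝ} (u v : Fin n) :
    ∃ t s, Exec I ω capProg (initState ε u v) t s ∧ t ≤ 6 + 2 * n.size + ⌈1 / ε⌉₊.size ∧
      Started u v (min ⌈1 / ε⌉₊ n) s := by
  set s₀ := initState ε u v with hs₀
  have h0 : s₀.reg 0 = n := rfl
  have h1 : s₀.reg 1 = ⌈1 / ε⌉₊ := rfl
  have h2 : s₀.reg 2 = u := rfl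
  have h3 : s₀.reg 3 = v := rfl
  have hr : ∀ r, 3 < r → s₀.reg r = 0 := by
    intro r hr
    obtain ⟨r, rfl⟩ := Nat.exists_eq_add_of_lt hr
    rw [show 3 + r + 1 = r + 4 by ring]
    rfl
  set s₁ := blockExec I ω [const 4 1, op lt 20 0 1] s₀ with hs₁
  have e20 : s₁.reg 20 = if n < ⌈1 / ε⌉₊ then 1 else 0 := by
    simp [hs₁, blockExec, exec, BinOp.eval, h0, h1]
  have er : ∀ r, r ≠ 4 → r ≠ 20 → s₁.reg r = s₀.reg r := by
    intro r h1 h2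
    simp [hs₁, blockExec, exec, h1, h2]
  have e4 : s₁.reg 4 = 1 := by simp [hs₁, blockExec, exec]
  have hstart : Started u v ⌈1 / ε⌉₊ s₁ :=
    ⟨er 0 (by omega) (by omega), er 1 (by omega) (by omega), er 2 (by omega) (by omega),
      er 3 (by omega) (by omega), e4,
      fun r h4 h20 => (er r (by omega) h20).trans (hr r (by omega)),
      by rw [e20]; split_ifs <;> omega, rfl, rfl⟩
  have hexec : Exec I ω (block [const 4 1, op lt 20 0 1]) s₀
      ((const 4 1 : Instr).cost I s₀ + ((op lt 20 0 1).cost I ((const 4 1).exec I ω s₀) + 0)) s₁ :=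
    .seq (.instr _ _) (.seq (.instr _ _) (.skip _))
  have hcost : (const 4 1 : Instr).cost I s₀ + ((op lt 20 0 1).cost I ((const 4 1).exec I ω s₀) + 0)
      = 3 + n.size + ⌈1 / ε⌉₊.size := by
    simp [Instr.cost, exec, h0, h1]
    ring
  rw [hcost] at hexec
  by_cases hlt : n < ⌈1 / ε⌉₊
  · rw [if_pos hlt] at e20
    refine ⟨_, _, .seq hexec (.iteTrue (by simp [e20]) (.seq (.instr _ _) (.skip _))), ?_, ?_⟩
    · simp [Instr.cost, e20, hstart.nodes, hstart.rest]
      omega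
    · rw [min_eq_right hlt.le]
      refine ⟨?_, ?_, ?_, ?_, ?_, fun r h4 h20 => ?_, ?_, rfl, rfl⟩
      · simp [exec, hstart.nodes]
      · simp [exec, BinOp.eval, hstart.nodes, hstart.rest]
      · simp [exec, hstart.left]
      · simp [exec, hstart.right]
      · simp [exec, hstart.one]
      · have : r ≠ 1 := by omega
        simp [exec, this, hstart.rest r h4 h20]
      · simp [exec, e20]
  · rw [if_neg hlt] at e20
    refine ⟨_, _, .seq hexec (.iteFalse e20 (.skip _)), by omega, ?_⟩
    rwa [min_eq_left (not_lt.1 hlt)]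

end Setup

/-! ### The main theorem -/

theorem size_bound_le (K n : ℕ) : (K * (n + 1) ^ 4).size ≤ K.size + 4 * n.size := by
  rw [Nat.size_le, pow_add]
  have h1 : n + 1 ≤ 2 ^ n.size := Nat.lt_size_self n
  have h2 : (n + 1) ^ 4 ≤ 2 ^ (4 * n.size) := by
    rw [mul_comm 4, pow_mul]
    exact Nat.pow_le_pow_left h1 4
  exact Nat.mul_lt_mul_of_lt_of_le (Nat.lt_size_self K) h2 (by positivity)

/-- The `n * q * K * n.size ^ 2` samples dominate, with `O(n.size)` steps each; the star forest
takes `O(n * n.size)` steps. -/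
theorem steps_le {n q K : ℕ} (hn : 0 < n) (hq : 0 < q) (hK : 0 < K) :
    (3 * n.size + 8) + (((6 * n.size + 40) * n + (13 * n + 4) * n.size + 2) +
      (((11 * n.size + 39) * (n * (q * K * n.size * n.size)) + 2) + (6 * n.size + 9))) ≤
      200 * (K * (n * q * n.size ^ 3)) := by
  have hL : 0 < n.size := Nat.size_pos.2 hn
  generalize n.size = L at hL ⊢
  have h1 : n * L ≤ K * (n * q * L ^ 3) :=
    calc n * L = 1 * (n * 1 * (L * 1)) := by ring
      _ ≤ K * (n * q * (L * L ^ 2)) := by gcongr <;> first | omega | exact Nat.one_le_pow _ _ hL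
      _ = K * (n * q * L ^ 3) := by ring
  have h2 : L ≤ n * L := Nat.le_mul_of_pos_left _ hn
  have h3 : n ≤ n * L := Nat.le_mul_of_pos_right _ hL
  have h4 : (11 * L + 39) * (n * (q * K * L * L)) ≤ 50 * (K * (n * q * L ^ 3)) :=
    calc (11 * L + 39) * (n * (q * K * L * L)) ≤ (50 * L) * (n * (q * K * L * L)) := by
          gcongr
          omega
      _ = 50 * (K * (n * q * L ^ 3)) := by ring
  have h5 : (6 * L + 40) * n = 6 * (n * L) + 40 * n := by ring
  have h6 : (13 * n + 4) * L = 13 * (n * L) + 4 * L := by ring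
  rw [h5, h6]
  omega

theorem size_le_one_add_log {n : ℕ} (hn : 0 < n) : (n.size : ℝ) ≤ 2 * (1 + Real.log n) := by
  have hL : 0 < n.size := Nat.size_pos.2 hn
  have h1 : 2 ^ (n.size - 1) ≤ n := Nat.lt_size.1 (by omega)
  have h2 : ((n.size - 1 : ℕ) : ℝ) * Real.log 2 ≤ Real.log n := by
    rw [← Real.log_pow]
    refine Real.log_le_log (by positivity) ?_
    exact_mod_cast h1
  have h3 : ((n.size - 1 : ℕ) : ℝ) = n.size - 1 := by
    rw [Nat.cast_sub hL, Nat.cast_one]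
  have h4 : (0 : ℝ) ≤ ((n.size - 1 : ℕ) : ℝ) := Nat.cast_nonneg _
  have h5 := Real.log_two_gt_d9
  rw [h3] at h2 h4
  nlinarith

theorem Started.bdd {n q N : ℕ} {u v : Fin n} {s : State} (h : Started u v q s) (hq : q ≤ n)
    (hN : n < N) : s.Bdd N := by
  refine ⟨fun r => ?_, fun a => by simp [h.mem]⟩
  have hu := u.2
  have hv := v.2
  by_cases h20 : r = 20
  · subst h20
    exact h.tmp.trans (by omega)
  · rcases lt_or_ge 4 r with hr | hr
    · rw [h.rest r hr h20]
      exact Nat.zero_le _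
    · interval_cases r
      · rw [h.nodes]; omega
      · rw [h.param]; omega
      · rw [h.left]; omega
      · rw [h.right]; omega
      · rw [h.one]; omega

theorem exec_sssProg {K n : ℕ} (hK : 4 ≤ K) (I : GraphInput n) (ω : ℕ → Bool) {ε : ℝ}
    (hε : 0 < ε) {u v : Fin n} (huv : I.graph.Adj u v) :
    ∃ t s, Exec I ω (sssProg K) (initState ε u v) t s ∧
      t ≤ 6 + 2 * n.size + ⌈1 / ε⌉₊.size +
        200 * (K * (n * min ⌈1 / ε⌉₊ n * n.size ^ 3)) * (1 + 3 * (K.size + 4 * n.size)) ∧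
      (s.reg 0 ≠ 0 ↔ (I.sparseSubgraph ω (K * min ⌈1 / ε⌉₊ n * n.size ^ 2)).Adj u v) := by
  have hn : 0 < n := u.pos
  obtain ⟨t₁, s₁, hexec₁, ht₁, hs₁⟩ := exec_capProg (I := I) (ω := ω) (ε := ε) u v
  have hq : 0 < min ⌈1 / ε⌉₊ n := lt_min (Nat.ceil_pos.2 (by positivity)) hn
  have hqn : min ⌈1 / ε⌉₊ n ≤ n := min_le_right _ _
  set q := min ⌈1 / ε⌉₊ n with hq_def
  -- The fourth power leaves room for the total number of samples, since `q` and `n.size` are at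
  -- most `n`.
  set N := K * (n + 1) ^ 4 with hN_def
  have hpow : n + 1 ≤ (n + 1) ^ 4 := Nat.le_self_pow (by norm_num) _
  have hN : 4 * n + 4 ≤ N := by
    have := Nat.mul_le_mul hK hpow
    omega
  have hKN : K ≤ N := Nat.le_mul_of_pos_right _ (by positivity)
  have hkN : n * (q * K * n.size * n.size) ≤ N :=
    calc n * (q * K * n.size * n.size) ≤ n * (n * K * n * n) := by
          have := size_le_self n
          gcongr
      _ = K * n ^ 4 := by ring
      _ ≤ N := by
          rw [hN_def]
          gcongr
          omega
  obtain ⟨t₂, s₂, hexec₂, ht₂, -, hans⟩ :=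
    halts_mainProg (I := I) (ω := ω) hN hKN hkN hs₁ (hs₁.bdd hqn (by omega))
  refine ⟨t₁ + t₂, s₂, .seq hexec₁ hexec₂, add_le_add ht₁ (ht₂.trans ?_), ?_⟩
  · have h1 : N.size ≤ K.size + 4 * n.size := size_bound_le K n
    exact Nat.mul_le_mul (steps_le hn hq (by omega)) (by omega)
  · rw [hans, show q * K * n.size * n.size = K * q * n.size ^ 2 by ring]
    exact or_congr_right (and_iff_right huv).symm

/-- The 10 collects the capping phase, 400 is 200 doubled by `⌈1 / ε⌉ ≤ 2 / ε`, and 16 is `2 ^ 4`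
from `n.size ≤ 2 * (1 + log n)`. -/
theorem time_le {K n t : ℕ} {ε : ℝ} (hn : 0 < n) (hε : 0 < ε) (hε1 : ε < 1)
    (ht : t ≤ 6 + 2 * n.size + ⌈1 / ε⌉₊.size +
        200 * (K * (n * min ⌈1 / ε⌉₊ n * n.size ^ 3)) * (1 + 3 * (K.size + 4 * n.size))) :
    (t : ℝ) ≤ 16 * (10 + 400 * K * (13 + 3 * K.size)) * (n * ε⁻¹) * (1 + Real.log n) ^ 4 := by
  have hL : 1 ≤ n.size := Nat.size_pos.2 hn
  have hlog := size_le_one_add_log hn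
  have hceil : (⌈1 / ε⌉₊ : ℝ) ≤ 2 * ε⁻¹ := by
    have h1 : (⌈1 / ε⌉₊ : ℝ) < 1 / ε + 1 := Nat.ceil_lt_add_one (by positivity)
    have h2 : 1 ≤ ε⁻¹ := (one_le_inv₀ hε).2 hε1.le
    have h3 : 1 / ε = ε⁻¹ := one_div ε
    linarith
  have h1 : t ≤ 8 * n.size + ⌈1 / ε⌉₊ +
      200 * (K * (n * ⌈1 / ε⌉₊ * n.size ^ 3)) * ((13 + 3 * K.size) * n.size) := by
    refine ht.trans (add_le_add (add_le_add (by omega) (size_le_self _)) ?_)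
    gcongr
    · exact min_le_left _ _
    · nlinarith
  have hE : 1 ≤ ε⁻¹ := (one_le_inv₀ hε).2 hε1.le
  have hL' : (1 : ℝ) ≤ n.size := by exact_mod_cast hL
  have hn' : (1 : ℝ) ≤ n := by exact_mod_cast hn
  have hL4 : (n.size : ℝ) ≤ (n.size : ℝ) ^ 4 := le_self_pow₀ hL' (by norm_num)
  have hL4' : (1 : ℝ) ≤ (n.size : ℝ) ^ 4 := one_le_pow₀ hL'
  have hnE : 1 ≤ (n : ℝ) * ε⁻¹ := one_le_mul_of_one_le_of_one_le hn' hE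
  have ht' : (t : ℝ) ≤ 8 * n.size + ⌈1 / ε⌉₊ +
      200 * (K * (n * ⌈1 / ε⌉₊ * n.size ^ 3)) * ((13 + 3 * K.size) * n.size) := by
    exact_mod_cast h1
  calc (t : ℝ) ≤ _ := ht'
    _ ≤ 8 * n.size + 2 * ε⁻¹ +
        200 * (K * (n * (2 * ε⁻¹) * n.size ^ 3)) * ((13 + 3 * K.size) * n.size) := by gcongr
    _ ≤ 8 * (n * ε⁻¹ * n.size ^ 4) + 2 * (n * ε⁻¹ * n.size ^ 4) +
        200 * (K * (n * (2 * ε⁻¹) * n.size ^ 3)) * ((13 + 3 * K.size) * n.size) := by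
        gcongr
        · exact hL4.trans (le_mul_of_one_le_left (by positivity) hnE)
        · calc ε⁻¹ ≤ n * ε⁻¹ := le_mul_of_one_le_left (by positivity) hn'
            _ ≤ _ := le_mul_of_one_le_right (by positivity) hL4'
    _ = (10 + 400 * K * (13 + 3 * K.size)) * (n * ε⁻¹) * (n.size : ℝ) ^ 4 := by ring
    _ ≤ (10 + 400 * K * (13 + 3 * K.size)) * (n * ε⁻¹) * (2 * (1 + Real.log n)) ^ 4 := by gcongr
    _ = _ := by ring

end SSSLocal

theorem mainTheorem9 (c : ℕ) :
    ∃ (P : SSSLocal.Prog) (C : ℝ) (d : ℕ),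
      SSSLocal.IsLCAForSSS P
        (fun n ε => C * ((n : ℝ) * ε⁻¹) * (1 + Real.log n) ^ d)
        (fun n => 1 / (n : ℝ) ^ c) := by
  set K := 8 * (c + 2) with hK
  refine ⟨SSSLocal.sssProg K, 16 * (10 + 400 * K * (13 + 3 * K.size)), 4, ?_⟩
  intro n I ε hε hε1
  refine ⟨fun ω u v huv => ?_, ?_⟩
  · obtain ⟨t, s, hexec, ht, -⟩ := SSSLocal.exec_sssProg (K := K) (by omega) I ω hε huv
    exact ⟨t, s, hexec, SSSLocal.time_le u.pos hε hε1 ht⟩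
  · rcases Nat.eq_zero_or_pos n with rfl | hn
    · have h : {ω | SSSLocal.SolvesSSS (SSSLocal.sssProg K) I ε ω} = Set.univ := by
        refine Set.eq_univ_of_forall fun ω => ⟨⊥, ⟨bot_le, fun u => u.elim0, ?_⟩, fun u => u.elim0⟩
        simp
      rw [h, MeasureTheory.measure_univ]
      refine ENNReal.ofReal_le_one.2 (sub_le_self _ ?_)
      positivity
    · set q := min ⌈1 / ε⌉₊ n with hq_def
      have hceil : 0 < ⌈1 / ε⌉₊ := Nat.ceil_pos.2 (by positivity)
      have hq : 0 < q := lt_min hceil hn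
      -- If the cap is active, then `n / q = 1`, which the summand 1 absorbs.
      have hqε : (n : ℝ) / q ≤ ε * n + 1 := by
        have hn' : (0 : ℝ) < n := by exact_mod_cast hn
        rcases min_choice ⌈1 / ε⌉₊ n with h | h
        · rw [hq_def, h]
          have h1 : 1 / ε ≤ ⌈1 / ε⌉₊ := Nat.le_ceil _
          rw [div_le_iff₀ (by exact_mod_cast hceil)]
          rw [div_le_iff₀ hε] at h1
          nlinarith
        · rw [hq_def, h, div_self hn'.ne']
          have : 0 < ε * n := by positivity
          linarith
      refine (I.le_tapeMeasure_crossing_le c q hn).trans (MeasureTheory.measure_mono fun ω hω => ?_)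
      refine ⟨I.sparseSubgraph ω (K * q * n.size ^ 2), I.isSSS_sparseSubgraph hn hq hqε hω, ?_⟩
      intro u v huv
      obtain ⟨t, s, hexec, -, hans⟩ :=
        SSSLocal.exec_sssProg (K := K) (by omega) I ω hε huv
      rw [← hans]
      exact ⟨fun ⟨_, _, hexec', h0⟩ => hexec.deterministic hexec' ▸ h0, fun h0 => ⟨t, s, hexec, h0⟩⟩
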